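/- Let $\mathbb H$ be the quaternions, $\mathbb S=\{J\in\mathbb H: J^2=-1\}$, and, for $x=\alpha+J\beta$ with $\alpha,\beta\in\mathbb R$, $J\in\mathbb S$, let $\mathbb S_x=\alpha+\mathbb S\beta$. Let $n\ge 1$, let $\mathbb R_\bullet\subset\mathbb H^n$ be the set of points with at least one real component, and for $U\subseteq\mathbb H^n$ let $\widetilde U=\bigcup_{x\in U}\mathbb S_{x_1}\times\cdots\times\mathbb S_{x_n}$ be its symmetric completion. *Slice functions.* Let $D\subseteq\mathbb C^n$ be invariant under the conjugation $z\mapsto\overline z^h$ of each variable $z_h$. A stem function on $D$ is a family $(F_K)_{K\subseteq\{1,\dots,n\}}$ of functions $F_K:D\to\mathbb H$ with $F_K(\overline z^h)=F_K(z)$ if $h\notin K$ and $F_K(\overline z^h)=-F_K(z)$ if $h\in K$. It induces the slice function $g(\alpha_1+J_1\beta_1,\dots,\alpha_n+J_n\beta_n)=\sum_K J_KF_K(\alpha_1+i\beta_1,\dots,\alpha_n+i\beta_n)$ on $\Omega_D=\{(\alpha_h+J_h\beta_h)_h: J_h\in\mathbb S,\ (\alpha_h+i\beta_h)_h\in D\}$,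 where $J_K=J_{k_1}\cdots J_{k_p}$ for $K=\{k_1<\dots<k_p\}$ and $J_\emptyset=1$. *The functions $\Gamma^m_K(f)$.* Write $x_m=x_{m0}+ix_{m1}+jx_{m2}+kx_{m3}$, $L^m_{ab}=x_{ma}\partial_{x_{mb}}-x_{mb}\partial_{x_{ma}}$ and $\Gamma_{x_m}=-\frac12\sum_{a,b=1}^3e_ae_bL^m_{ab}$, where $(e_1,e_2,e_3)=(i,j,k)$. For $U$ open, $f\in\mathcal C^n(U\setminus\mathbb R_\bullet,\mathbb H)$, $0\le m\le n$ and $K\subseteq\{1,\dots,m\}$, define on $U\setminus\mathbb R_\bullet$: $\Gamma^0_\emptyset(f)=f$ and, for $m\ge1$, $\Gamma^m_K(f)=(2\,\mathrm{Im}(x_m))^{-1}\Gamma_{x_m}\big(x_m^{\mathbf 1_K(m)}\Gamma^{m-1}_{K\setminus\{m\}}(f)\big)$. A function $f\in\mathcal C^0(U,\mathbb H)\cap\mathcal C^n(U\setminus\mathbb R_\bullet,\mathbb H)$ is called *strongly slice* (respectively *locally strongly slice*) in $U$ if for every $y\in U\setminus\mathbb R_\bullet$, every $m\in\{1,\dots,n\}$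 and every $K\subseteq\{1,\dots,m\}$, the function $\Gamma^m_K(f)$ is constant (respectively locally constant) on $(\mathbb S_{y_1}\times\cdots\times\mathbb S_{y_m}\times\{y_{m+1}\}\times\cdots\times\{y_n\})\cap U$. **Theorem.** Let $U\subseteq\mathbb H^n$ be open and let $f\in\mathcal C^0(U,\mathbb H)\cap\mathcal C^n(U\setminus\mathbb R_\bullet,\mathbb H)$. (i) $f$ is strongly slice in $U$ if and only if it can be extended to a continuous slice function on $\widetilde U$, of class $\mathcal C^n$ on $\widetilde U\setminus\mathbb R_\bullet$. If this is the case, the extension is unique. (ii) $f$ is locally strongly slice in $U$ if and only if for each $y\in U$ there exist an open neighbourhood $U_y\subseteq U$ of $y$ and a continuous slice function $\widetilde f^{(y)}$ on $\widetilde{U_y}$, of class $\mathcal C^n$ on $\widetilde{U_y}\setminus\mathbb R_\bullet$, that extends the restriction $f_{|U_y}$. -/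

import Mathlib

open scoped Quaternion

noncomputable section

namespace QuatSlice

/-- The set `𝕊` of imaginary units of the quaternions. -/
def imUnits : Set ℍ[ℝ] := {J | J * J = -1}

/-- For `z = α + iβ`, the quaternion `φ_J(z) = α + Jβ`. -/
def phi (J : ℍ[ℝ]) (z : ℂ) : ℍ[ℝ] := (z.re : ℍ[ℝ]) + z.im • J

/-- `𝕊_q = α + 𝕊β` if `q = α + Jβ` with `J ∈ 𝕊`; it is `{q}` when `q` is real. -/
def sphere (q : ℍ[ℝ]) : Set ℍ[ℝ] :=
  {p | ∃ z : ℂ, (∃ J ∈ imUnits, q = phi J z) ∧ ∃ I ∈ imUnits, p = phi I z}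

variable {n : ℕ}

/-- The set `ℝ_•` of the points of `ℍⁿ` having at least one real component. -/
def realLocus (n : ℕ) : Set (Fin n → ℍ[ℝ]) := {x | ∃ h : Fin n, ∃ r : ℝ, x h = (r : ℍ[ℝ])}

/-- The symmetric completion: the union, over `x ∈ U`, of `𝕊_{x_1} × ⋯ × 𝕊_{x_n}`. -/
def symmCompletion (U : Set (Fin n → ℍ[ℝ])) : Set (Fin n → ℍ[ℝ]) :=
  {x' | ∃ x ∈ U, ∀ h, x' h ∈ sphere (x h)}

/-- The partial sphere `𝕊_{y_1} × ⋯ × 𝕊_{y_m} × {y_{m+1}} × ⋯ × {y_n}`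
(the components are indexed by `0, …, n-1`, so the rotating ones are those of index `< m`). -/
def partialSphere (m : ℕ) (y : Fin n → ℍ[ℝ]) : Set (Fin n → ℍ[ℝ]) :=
  {x | ∀ h : Fin n, ((h : ℕ) < m → x h ∈ sphere (y h)) ∧ (m ≤ (h : ℕ) → x h = y h)}

/-! ### Slice functions -/

/-- Conjugation of the `h`-th complex variable. -/
def conjAt (h : Fin n) (z : Fin n → ℂ) : Fin n → ℂ :=
  Function.update z h ((starRingEnd ℂ) (z h))

/-- `D ⊆ ℂⁿ` is invariant under the conjugation of each variable. -/
def ConjInvariant (D : Set (Fin n → ℂ)) : Prop := ∀ z ∈ D, ∀ h, conjAt h z ∈ D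

/-- The axially symmetric set `Ω_D ⊆ ℍⁿ` associated to `D ⊆ ℂⁿ`. -/
def circularSet (D : Set (Fin n → ℂ)) : Set (Fin n → ℍ[ℝ]) :=
  {x | ∃ z ∈ D, ∃ J : Fin n → ℍ[ℝ], (∀ h, J h ∈ imUnits) ∧ x = fun h => phi (J h) (z h)}

/-- A function `F = ∑_K e_K F_K : D → ℍ ⊗ ℝ^{2ⁿ}`, given through its components `F_K = F · K`,
is a stem function on `D`. -/
def IsStem (D : Set (Fin n → ℂ)) (F : (Fin n → ℂ) → Finset (Fin n) → ℍ[ℝ]) : Prop :=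
  ∀ z ∈ D, ∀ (K : Finset (Fin n)) (h : Fin n),
    F (conjAt h z) K = if h ∈ K then -F z K else F z K

/-- The product `J_K = J_{k_1} ⋯ J_{k_p}`, where `K = {k_1 < ⋯ < k_p}`. -/
def orderedProd (J : Fin n → ℍ[ℝ]) (K : Finset (Fin n)) : ℍ[ℝ] :=
  (List.ofFn fun h => if h ∈ K then J h else 1).prod

/-- `g` is, on `Ω`, a slice function: `Ω = Ω_D` and `g = ℐ(F)` on `Ω` for a stem function `F`
on a conjugation invariant set `D`. -/
def IsSliceOn (g : (Fin n → ℍ[ℝ]) → ℍ[ℝ]) (Ω : Set (Fin n → ℍ[ℝ])) : Prop :=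
  ∃ (D : Set (Fin n → ℂ)) (F : (Fin n → ℂ) → Finset (Fin n) → ℍ[ℝ]),
    ConjInvariant D ∧ Ω = circularSet D ∧ IsStem D F ∧
    ∀ z ∈ D, ∀ J : Fin n → ℍ[ℝ], (∀ h, J h ∈ imUnits) →
      g (fun h => phi (J h) (z h)) = ∑ K : Finset (Fin n), orderedProd J K * F z K

/-! ### Spherical Dirac operators and the functions `Γ^m_K(f)` -/

/-- The units `e_1 = i`, `e_2 = j`, `e_3 = k`. -/
def unit : Fin 3 → ℍ[ℝ] := ![⟨0, 1, 0, 0⟩, ⟨0, 0, 1, 0⟩, ⟨0, 0, 0, 1⟩]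

/-- The imaginary real coordinates `x_1, x_2, x_3` of `x = x_0 + i x_1 + j x_2 + k x_3`. -/
def coord (q : ℍ[ℝ]) : Fin 3 → ℝ := ![q.imI, q.imJ, q.imK]

/-- The partial derivative `∂f/∂x_{m,j}`, `j = 1, 2, 3`. -/
def pderiv (m : Fin n) (j : Fin 3) (f : (Fin n → ℍ[ℝ]) → ℍ[ℝ]) (x : Fin n → ℍ[ℝ]) : ℍ[ℝ] :=
  fderiv ℝ f x (Pi.single m (unit j))

/-- The tangential operator `L^m_{ij} = x_{m,i} ∂/∂x_{m,j} - x_{m,j} ∂/∂x_{m,i}`. -/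
def tangential (m : Fin n) (i j : Fin 3) (f : (Fin n → ℍ[ℝ]) → ℍ[ℝ]) (x : Fin n → ℍ[ℝ]) :
    ℍ[ℝ] :=
  coord (x m) i • pderiv m j f x - coord (x m) j • pderiv m i f x

/-- The spherical Dirac operator `Γ_{x_m} = -(1/2) ∑_{i,j} e_i e_j L^m_{ij}`. -/
def sphDirac (m : Fin n) (f : (Fin n → ℍ[ℝ]) → ℍ[ℝ]) (x : Fin n → ℍ[ℝ]) : ℍ[ℝ] :=
  (-(1 / 2 : ℝ)) • ∑ i : Fin 3, ∑ j : Fin 3, unit i * unit j * tangential m i j f x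

/-- The functions `Γ^m_K(f)`, for `m ≤ n` and `K` a set of indices among the first `m`:
`Γ^0_∅(f) = f`, and, if `x_m` denotes the `m`-th variable,
`Γ^m_K(f) = (2 Im x_m)⁻¹ Γ_{x_m} (x_m^{1_K(m)} Γ^{m-1}_{K ∖ {m}}(f))`.
In the code the `(m+1)`-st variable is the one of index `m : Fin n`. -/
def gammaIter (f : (Fin n → ℍ[ℝ]) → ℍ[ℝ]) :
    ℕ → Finset (Fin n) → (Fin n → ℍ[ℝ]) → ℍ[ℝ]
  | 0, _ => f
  | m + 1, K =>
    if h : m < n then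
      fun x => (2 * (x ⟨m, h⟩).im)⁻¹ *
        sphDirac ⟨m, h⟩
          (fun y => y ⟨m, h⟩ ^ (if (⟨m, h⟩ : Fin n) ∈ K then 1 else 0) *
            gammaIter f m (K.erase ⟨m, h⟩) y) x
    else gammaIter f m K

/-- `f` is strongly slice in `U`: every `Γ^m_K(f)`, `1 ≤ m ≤ n`, `K ⊆ {1, …, m}`, is constant on
the trace on `U` of the partial sphere `𝕊_{y_1} × ⋯ × 𝕊_{y_m} × {y_{m+1}} × ⋯ × {y_n}` of every
`y ∈ U ∖ ℝ_•`. To be used for `f` continuous on `U` and of class `Cⁿ` on `U ∖ ℝ_•`. -/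
def StronglySlice (f : (Fin n → ℍ[ℝ]) → ℍ[ℝ]) (U : Set (Fin n → ℍ[ℝ])) : Prop :=
  ∀ y ∈ U \ realLocus n, ∀ m : ℕ, 1 ≤ m → m ≤ n →
    ∀ K : Finset (Fin n), (∀ k ∈ K, (k : ℕ) < m) →
      ∀ a ∈ partialSphere m y ∩ U, ∀ b ∈ partialSphere m y ∩ U,
        gammaIter f m K a = gammaIter f m K b

/-- `f` is locally strongly slice in `U`: as before, with "locally constant" in place of
"constant". -/
def LocallyStronglySlice (f : (Fin n → ℍ[ℝ]) → ℍ[ℝ]) (U : Set (Fin n → ℍ[ℝ])) : Prop :=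
  ∀ y ∈ U \ realLocus n, ∀ m : ℕ, 1 ≤ m → m ≤ n →
    ∀ K : Finset (Fin n), (∀ k ∈ K, (k : ℕ) < m) →
      IsLocallyConstant ((partialSphere m y ∩ U).domRestrict (gammaIter f m K))

/-- `g` is, on the symmetric completion of `U`, a continuous slice function, of class `Cⁿ` off
`ℝ_•`, that extends the restriction of `f` to `U`. -/
structure IsSliceExtension (f : (Fin n → ℍ[ℝ]) → ℍ[ℝ]) (U : Set (Fin n → ℍ[ℝ]))
    (g : (Fin n → ℍ[ℝ]) → ℍ[ℝ]) : Prop where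
  eqOn : Set.EqOn g f U
  slice : IsSliceOn g (symmCompletion U)
  continuousOn : ContinuousOn g (symmCompletion U)
  contDiffOn : ContDiffOn ℝ n g (symmCompletion U \ realLocus n)

end QuatSlice

end

/-! Both halves pass through `SliceOnTori`: on every torus without real components, `f` coincides at
the points of `U` with a real combination of functions `x_{k_1} ⋯ x_{k_p} c`, `k_1 < ⋯ < k_p`
(`sliceTail n 0`). On such a torus these are exactly the slice functions, since `J_h` is an affine
function of `x_h` there.

From constancy to tori: write `Γ` for the Dirac operator in `x_m`. The Leibniz rule `Γ(x_m h) = 2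
Im(x_m) h + x̄_m Γ h` (`sphDirac_mul`) shows that `Γ^m_K` equals `Γ^{m+1}_{K ∪ {m}} - x̄_m
Γ^{m+1}_K`, variables being numbered from 0 (`gammaIter_eq_sub`). As `x̄_m = 2 Re x_m - x_m` and `Re
x_m` is constant on a torus, descending from constant `Γ^n_K` to `Γ^0_∅ = f` adds one variable on
the left at each step. Conversely, if `Γ^m_K = A + x_m B` on a torus, with `A` and `B` depending on
later variables only, then `Γ`, being tangential, returns `2 Im(x_m) B` (`sphDirac_of_eqOn_torus`).
So each step removes one variable, and the result is constant on partial spheres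
(`gammaIter_mem_sliceTail`).

The extension comes from interpolation (`exists_interpolation`). If `1 + J_0, …, 1 + J_3` is a basis
of `ℍ`, every imaginary unit is an affine combination of the `J_j`, and the `J_j` may be taken near
any given unit (`span_one_add_imUnits`). A function that is affine in each variable is therefore
recovered, all along the torus, from its values at nodes in `U`, with weights and nodes that are
continuous, and smooth off `ℝ_•`. This forces uniqueness and gives regularity; density of the
complement of `ℝ_•` and continuity settle the real components. The stem function is a Fourier
transform over the signs of the units `±i` (`stemComp`).

The local statement reduces to the global one on a product of balls whose traces on the spheres are
connected (`isPreconnected_sphere_inter_ball`). -/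

noncomputable section

namespace QuatSlice

/-! ### Imaginary units, spheres, tori and the real locus. -/

section

lemma norm_im_sq (q : ℍ[ℝ]) : ‖q.im‖ ^ 2 = q.imI ^ 2 + q.imJ ^ 2 + q.imK ^ 2 := by
  rw [sq, ← Quaternion.normSq_eq_norm_mul_self, Quaternion.normSq_def']
  simp

lemma mem_imUnits_iff {J : ℍ[ℝ]} : J ∈ imUnits ↔ J.re = 0 ∧ ‖J.im‖ = 1 := by
  have h1 : ‖J.im‖ = 1 ↔ J.imI ^ 2 + J.imJ ^ 2 + J.imK ^ 2 = 1 := by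
    rw [← norm_im_sq]
    exact (pow_eq_one_iff_of_nonneg (norm_nonneg _) two_ne_zero).symm
  rw [h1, imUnits, Set.mem_ofPred_eq, Quaternion.ext_iff]
  simp only [Quaternion.re_mul, Quaternion.imI_mul, Quaternion.imJ_mul, Quaternion.imK_mul,
    Quaternion.re_neg, Quaternion.imI_neg, Quaternion.imJ_neg, Quaternion.imK_neg,
    Quaternion.re_one, Quaternion.imI_one, Quaternion.imJ_one, Quaternion.imK_one]
  constructor
  · rintro ⟨h0, hi, hj, hk⟩
    have hre : J.re = 0 := by
      by_contra hne
      have hi' : J.imI = 0 := by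
        have : J.re * J.imI = 0 := by linarith
        simpa [hne] using this
      have hj' : J.imJ = 0 := by
        have : J.re * J.imJ = 0 := by linarith
        simpa [hne] using this
      have hk' : J.imK = 0 := by
        have : J.re * J.imK = 0 := by linarith
        simpa [hne] using this
      rw [hi', hj', hk'] at h0
      nlinarith [sq_nonneg J.re]
    exact ⟨hre, by rw [hre] at h0; linarith⟩
  · rintro ⟨h0, h⟩
    rw [h0]
    refine ⟨by linarith, by ring, by ring, by ring⟩

lemma phi_re (J : ℍ[ℝ]) (hJ : J ∈ imUnits) (z : ℂ) : (phi J z).re = z.re := by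
  simp [phi, (mem_imUnits_iff.1 hJ).1]

lemma phi_im (J : ℍ[ℝ]) (z : ℂ) : (phi J z).im = z.im • J.im := by
  ext <;> simp [phi]

lemma norm_phi_im (J : ℍ[ℝ]) (hJ : J ∈ imUnits) (z : ℂ) : ‖(phi J z).im‖ = |z.im| := by
  rw [phi_im, norm_smul, (mem_imUnits_iff.1 hJ).2, mul_one, Real.norm_eq_abs]

/-- The imaginary unit `i`. -/
def unitI : ℍ[ℝ] := ⟨0, 1, 0, 0⟩

lemma unitI_mem : unitI ∈ imUnits := by
  have h := norm_im_sq unitI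
  rw [mem_imUnits_iff]
  refine ⟨rfl, (pow_eq_one_iff_of_nonneg (norm_nonneg _) two_ne_zero).1 ?_⟩
  rw [h]
  simp [unitI]

open Classical in
/-- An imaginary unit `J` with `q ∈ ℝ + Jℝ`. -/
def imUnit (q : ℍ[ℝ]) : ℍ[ℝ] := if q.im = 0 then unitI else ‖q.im‖⁻¹ • q.im

/-- The complex number `re q + i ‖im q‖`. -/
def toComplex (q : ℍ[ℝ]) : ℂ := ⟨q.re, ‖q.im‖⟩

lemma imUnit_mem (q : ℍ[ℝ]) : imUnit q ∈ imUnits := by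
  unfold imUnit
  split_ifs with h
  · exact unitI_mem
  · rw [mem_imUnits_iff]
    refine ⟨by simp, ?_⟩
    have : (‖q.im‖⁻¹ • q.im).im = ‖q.im‖⁻¹ • q.im := by ext <;> simp
    rw [this, norm_smul, norm_inv, norm_norm, inv_mul_cancel₀ (norm_ne_zero_iff.2 h)]

lemma phi_toComplex (q : ℍ[ℝ]) : phi (imUnit q) (toComplex q) = q := by
  unfold phi toComplex imUnit
  split_ifs with h
  · rw [h]
    simp only [norm_zero, zero_smul, add_zero]
    conv_rhs => rw [← Quaternion.re_add_im q, h, add_zero]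
  · simp only [smul_smul, mul_inv_cancel₀ (norm_ne_zero_iff.2 h), one_smul]
    exact Quaternion.re_add_im q

/-- The choice of `z` and `J` is invisible in the real part and in the norm of the imaginary part.
This form makes lying on a common sphere visibly an equivalence relation. -/
lemma mem_sphere_iff {p q : ℍ[ℝ]} : p ∈ sphere q ↔ p.re = q.re ∧ ‖p.im‖ = ‖q.im‖ := by
  constructor
  · rintro ⟨z, ⟨J, hJ, rfl⟩, I, hI, rfl⟩
    rw [phi_re _ hJ, phi_re _ hI, norm_phi_im _ hJ, norm_phi_im _ hI]
    exact ⟨rfl, rfl⟩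
  · rintro ⟨h1, h2⟩
    refine ⟨toComplex q, ⟨imUnit q, imUnit_mem q, (phi_toComplex q).symm⟩,
      imUnit p, imUnit_mem p, ?_⟩
    rw [toComplex, ← h1, ← h2]
    exact (phi_toComplex p).symm

lemma isReal_iff (q : ℍ[ℝ]) : (∃ r : ℝ, q = (r : ℍ[ℝ])) ↔ q.im = 0 := by
  constructor
  · rintro ⟨r, rfl⟩
    simp
  · intro h
    exact ⟨q.re, by conv_lhs => rw [← Quaternion.re_add_im q, h, add_zero]⟩

variable {n : ℕ}

lemma notMem_realLocus {x : Fin n → ℍ[ℝ]} : x ∉ realLocus n ↔ ∀ h, (x h).im ≠ 0 := by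
  simp [realLocus, isReal_iff]

/-- The product of the spheres `𝕊_{x_h}`. -/
def torus (x : Fin n → ℍ[ℝ]) : Set (Fin n → ℍ[ℝ]) := {p | ∀ h, p h ∈ sphere (x h)}

lemma mem_torus_iff {p x : Fin n → ℍ[ℝ]} :
    p ∈ torus x ↔ ∀ h, (p h).re = (x h).re ∧ ‖(p h).im‖ = ‖(x h).im‖ := by
  simp [torus, mem_sphere_iff]

lemma mem_torus_self (x : Fin n → ℍ[ℝ]) : x ∈ torus x := by simp [mem_torus_iff]

lemma mem_torus_symm {p x : Fin n → ℍ[ℝ]} (h : p ∈ torus x) : x ∈ torus p := by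
  rw [mem_torus_iff] at *
  exact fun k => ⟨(h k).1.symm, (h k).2.symm⟩

lemma mem_torus_trans {p q x : Fin n → ℍ[ℝ]} (h : p ∈ torus q) (h' : q ∈ torus x) :
    p ∈ torus x := by
  rw [mem_torus_iff] at *
  exact fun k => ⟨(h k).1.trans (h' k).1, (h k).2.trans (h' k).2⟩

lemma notMem_realLocus_of_mem_torus {p x : Fin n → ℍ[ℝ]} (h : p ∈ torus x)
    (hx : x ∉ realLocus n) : p ∉ realLocus n := by
  rw [notMem_realLocus] at *
  intro k hk
  have := ((mem_torus_iff.1 h) k).2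
  rw [hk, norm_zero] at this
  exact hx k (norm_eq_zero.1 this.symm)

lemma subset_symmCompletion (U : Set (Fin n → ℍ[ℝ])) : U ⊆ symmCompletion U :=
  fun x hx => ⟨x, hx, mem_torus_self x⟩

lemma mem_symmCompletion_of_mem_torus {U : Set (Fin n → ℍ[ℝ])} {x p : Fin n → ℍ[ℝ]}
    (hx : x ∈ symmCompletion U) (hp : p ∈ torus x) : p ∈ symmCompletion U := by
  obtain ⟨y, hy, h⟩ := hx
  exact ⟨y, hy, mem_torus_trans hp h⟩

lemma phi_mem_torus (z : Fin n → ℂ) {J I : Fin n → ℍ[ℝ]} (hJ : ∀ h, J h ∈ imUnits)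
    (hI : ∀ h, I h ∈ imUnits) :
    (fun h => phi (J h) (z h)) ∈ torus (fun h => phi (I h) (z h)) := by
  rw [mem_torus_iff]
  intro h
  simp only [phi_re _ (hJ h), phi_re _ (hI h), norm_phi_im _ (hJ h), norm_phi_im _ (hI h)]
  simp

lemma isClosed_realLocus : IsClosed (realLocus n) := by
  have : realLocus n = ⋃ h : Fin n, {x | (x h).im = 0} := by
    ext x
    simp [realLocus, isReal_iff]
  rw [this]
  exact isClosed_iUnion_of_finite fun h => isClosed_eq
    (Quaternion.continuous_im.comp (continuous_apply h)) continuous_const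

lemma dense_im_ne_zero : Dense {q : ℍ[ℝ] | q.im ≠ 0} := by
  intro q
  rw [mem_closure_iff_seq_limit]
  by_cases hq : q.im = 0
  · refine ⟨fun k => q + (1 / ((k : ℝ) + 1)) • unitI, fun k => ?_, ?_⟩
    · intro h
      have h2 := congrArg (fun a : ℍ[ℝ] => a.imI) h
      rw [Quaternion.im_add, hq] at h2
      have h3 : (k : ℝ) + 1 = 0 := by
        have hi : unitI.imI = 1 := rfl
        simpa [hi] using h2
      linarith [(Nat.cast_nonneg k : (0 : ℝ) ≤ k)]
    · have := (tendsto_one_div_add_atTop_nhds_zero_nat (𝕜 := ℝ)).smul_const unitI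
      simpa using this.const_add q
  · exact ⟨fun _ => q, fun _ => hq, tendsto_const_nhds⟩

lemma dense_compl_realLocus : Dense (realLocus n)ᶜ := by
  have : (realLocus n)ᶜ = Set.pi Set.univ fun _ : Fin n => {q : ℍ[ℝ] | q.im ≠ 0} := by
    ext x
    simp [notMem_realLocus]
  rw [this]
  exact dense_pi _ fun _ _ => dense_im_ne_zero

end

/-! ### Ordered products and the multi-affine functions they span. -/

section

variable {n : ℕ}

lemma orderedProd_eq_mkPi (J : Fin n → ℍ[ℝ]) (K : Finset (Fin n)) :
    orderedProd J K =
      MultilinearMap.mkPiAlgebraFin ℝ n ℍ[ℝ] (fun h => if h ∈ K then J h else 1) := by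
  rw [MultilinearMap.mkPiAlgebraFin_apply, orderedProd]

lemma orderedProd_empty (J : Fin n → ℍ[ℝ]) : orderedProd J ∅ = 1 := by
  simp [orderedProd]

lemma orderedProd_congr {J I : Fin n → ℍ[ℝ]} {K : Finset (Fin n)} (h : ∀ k ∈ K, J k = I k) :
    orderedProd J K = orderedProd I K := by
  unfold orderedProd
  congr 2
  funext k
  split_ifs with hk
  · exact h k hk
  · rfl

/-- Expansion of an ordered product of real affine expressions. -/
lemma orderedProd_affine (a b : Fin n → ℝ) (K : Finset (Fin n)) :
    ∃ r : Finset (Fin n) → ℝ, ∀ J : Fin n → ℍ[ℝ],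
      orderedProd (fun h => a h • 1 + b h • J h) K = ∑ s, r s • orderedProd J s := by
  classical
  -- Outside `K` the factor `1` is read as `0 • J h + 1 • 1`, so subsets `s` not contained in `K`
  -- receive coefficient zero.
  refine ⟨fun s => ∏ h, if h ∈ s then (if h ∈ K then b h else 0) else if h ∈ K then a h else 1,
    fun J => ?_⟩
  rw [orderedProd_eq_mkPi]
  have h1 : (fun h => if h ∈ K then a h • (1 : ℍ[ℝ]) + b h • J h else 1) =
      (fun h => (if h ∈ K then b h else 0) • J h) +
        fun h => (if h ∈ K then a h else 1) • (1 : ℍ[ℝ]) := by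
    funext h
    simp only [Pi.add_apply]
    split_ifs <;> simp [add_comm]
  rw [h1, MultilinearMap.map_add_univ]
  refine Finset.sum_congr rfl fun s _ => ?_
  rw [orderedProd_eq_mkPi, ← MultilinearMap.map_smul_univ]
  congr 1
  funext h
  by_cases hs : h ∈ s <;> simp [hs]

/-- Ordered products are compatible with affine combinations in each factor. -/
lemma orderedProd_combination {ι : Type} [Fintype ι] (w : Fin n → ι → ℝ)
    (q : Fin n → ι → ℍ[ℝ]) (x : Fin n → ℍ[ℝ]) (hw : ∀ h, ∑ j, w h j = 1)
    (hq : ∀ h, ∑ j, w h j • q h j = x h) (K : Finset (Fin n)) :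
    orderedProd x K = ∑ r : Fin n → ι, (∏ h, w h (r h)) • orderedProd (fun h => q h (r h)) K := by
  classical
  rw [orderedProd_eq_mkPi]
  have h1 : (fun h => if h ∈ K then x h else 1) =
      fun h => ∑ j, w h j • (if h ∈ K then q h j else 1) := by
    funext h
    split_ifs
    · exact (hq h).symm
    · rw [← Finset.sum_smul, hw h, one_smul]
  rw [h1, MultilinearMap.map_sum]
  refine Finset.sum_congr rfl fun r _ => ?_
  rw [MultilinearMap.map_smul_univ, orderedProd_eq_mkPi]

lemma orderedProd_insert {m : Fin n} {K : Finset (Fin n)} (hK : ∀ k ∈ K, m < k)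
    (J : Fin n → ℍ[ℝ]) : orderedProd J (insert m K) = J m * orderedProd J K := by
  have key : ∀ L : Finset (Fin n), (∀ k ∈ L, m ≤ k) → orderedProd J L =
      (if m ∈ L then J m else 1) *
        ((List.ofFn fun h => if h ∈ L then J h else 1).drop (m + 1)).prod := by
    intro L hL
    have hlen : (m : ℕ) < (List.ofFn fun h => if h ∈ L then J h else 1).length := by simp
    have h1 : ((List.ofFn fun h => if h ∈ L then J h else 1).take m).prod = 1 := by
      refine List.prod_eq_one fun q hq => ?_
      rw [List.mem_take_iff_getElem] at hq
      obtain ⟨i, hi, rfl⟩ := hq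
      rw [List.getElem_ofFn, if_neg]
      intro hmem
      have := hL _ hmem
      rw [Fin.le_def] at this
      simp at this hi
      omega
    rw [orderedProd, ← List.prod_take_mul_prod_drop _ (m : ℕ), h1, one_mul,
      List.drop_eq_getElem_cons hlen, List.prod_cons, List.getElem_ofFn]
  have hm : m ∉ K := fun h => lt_irrefl _ (hK m h)
  rw [key (insert m K) (by simpa using fun k hk => (hK k hk).le), key K fun k hk => (hK k hk).le,
    if_pos (Finset.mem_insert_self _ _), if_neg hm, one_mul]
  congr 2
  apply List.ext_getElem
  · simp
  · intro i h1 h2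
    simp only [List.getElem_drop, List.getElem_ofFn, Finset.mem_insert]
    have : ¬ ((⟨m + 1 + i, by simp at h1; omega⟩ : Fin n) = m) := by
      intro h
      have := congrArg Fin.val h
      simp at this
      omega
    simp [this]

/-- The real vector space spanned by the functions `x ↦ x_{k_1} ⋯ x_{k_p} c` with
`m ≤ k_1 < ⋯ < k_p`. -/
def sliceTail (n m : ℕ) : Submodule ℝ ((Fin n → ℍ[ℝ]) → ℍ[ℝ]) :=
  Submodule.span ℝ {φ | ∃ (K : Finset (Fin n)) (c : ℍ[ℝ]), (∀ k ∈ K, m ≤ (k : ℕ)) ∧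
    φ = fun p => orderedProd p K * c}

lemma orderedProd_mul_mem_sliceTail {m : ℕ} {K : Finset (Fin n)} (hK : ∀ k ∈ K, m ≤ (k : ℕ))
    (c : ℍ[ℝ]) : (fun p => orderedProd p K * c) ∈ sliceTail n m :=
  Submodule.subset_span ⟨K, c, hK, rfl⟩

lemma const_mem_sliceTail (m : ℕ) (c : ℍ[ℝ]) : (fun _ => c) ∈ sliceTail n m := by
  have := orderedProd_mul_mem_sliceTail (n := n) (m := m) (K := ∅) (by simp) c
  simpa only [orderedProd_empty, one_mul] using this

lemma sliceTail_le (m : ℕ) : sliceTail n (m + 1) ≤ sliceTail n m := by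
  refine Submodule.span_mono ?_
  rintro φ ⟨K, c, hK, rfl⟩
  exact ⟨K, c, fun k hk => (Nat.le_succ m).trans (hK k hk), rfl⟩

/-- The order of the factors matters: `p m` enters on the left of products in later variables, which
is why variables are added from the last to the first. -/
lemma mul_mem_sliceTail (m : Fin n) {φ : (Fin n → ℍ[ℝ]) → ℍ[ℝ]}
    (hφ : φ ∈ sliceTail n (m + 1)) : (fun p => p m * φ p) ∈ sliceTail n m := by
  classical
  induction hφ using Submodule.span_induction with
  | mem φ h =>
    obtain ⟨K, c, hK, rfl⟩ := h
    have : (fun p : Fin n → ℍ[ℝ] => p m * (orderedProd p K * c)) =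
        fun p => orderedProd p (insert m K) * c := by
      funext p
      rw [orderedProd_insert (fun k hk => Fin.lt_def.2 (hK k hk)), mul_assoc]
    rw [this]
    refine orderedProd_mul_mem_sliceTail ?_ c
    simpa using fun k hk => (Nat.le_succ _).trans (hK k hk)
  | zero =>
    convert! (sliceTail n m).zero_mem
    simp
  | add φ ψ _ _ h1 h2 =>
    convert! (sliceTail n m).add_mem h1 h2 using 1
    funext p
    simp [mul_add]
  | smul r φ _ h1 =>
    convert! (sliceTail n m).smul_mem r h1 using 1
    funext p
    simp

/-- The generators split according to whether `m`, the smallest index allowed, occurs; if it does,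
it is the leftmost factor. -/
lemma exists_eq_add_mul_of_mem_sliceTail (m : Fin n) {φ : (Fin n → ℍ[ℝ]) → ℍ[ℝ]}
    (hφ : φ ∈ sliceTail n m) : ∃ A ∈ sliceTail n (m + 1), ∃ B ∈ sliceTail n (m + 1),
      ∀ p, φ p = A p + p m * B p := by
  classical
  induction hφ using Submodule.span_induction with
  | mem φ h =>
    obtain ⟨K, c, hK, rfl⟩ := h
    by_cases hm : m ∈ K
    · have hlt : ∀ k ∈ K.erase m, m < k := fun k hk =>
        lt_of_le_of_ne (Fin.le_def.2 (hK k (Finset.mem_of_mem_erase hk)))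
          (Finset.ne_of_mem_erase hk).symm
      refine ⟨0, Submodule.zero_mem _, fun p => orderedProd p (K.erase m) * c,
        orderedProd_mul_mem_sliceTail (fun k hk => hlt k hk) c, fun p => ?_⟩
      rw [← mul_assoc, ← orderedProd_insert hlt, Finset.insert_erase hm]
      simp
    · refine ⟨fun p => orderedProd p K * c, orderedProd_mul_mem_sliceTail (fun k hk => ?_) c,
        0, Submodule.zero_mem _, fun p => by simp⟩
      exact Nat.succ_le_of_lt (lt_of_le_of_ne (hK k hk) fun h => hm (Fin.ext h ▸ hk))
  | zero => exact ⟨0, Submodule.zero_mem _, 0, Submodule.zero_mem _, by simp⟩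
  | add φ ψ _ _ h1 h2 =>
    obtain ⟨A, hA, B, hB, h⟩ := h1
    obtain ⟨A', hA', B', hB', h'⟩ := h2
    refine ⟨A + A', Submodule.add_mem _ hA hA', B + B', Submodule.add_mem _ hB hB', fun p => ?_⟩
    simp only [Pi.add_apply, h, h', mul_add]
    abel
  | smul r φ _ h1 =>
    obtain ⟨A, hA, B, hB, h⟩ := h1
    refine ⟨r • A, Submodule.smul_mem _ r hA, r • B, Submodule.smul_mem _ r hB, fun p => ?_⟩
    simp only [Pi.smul_apply, h, smul_add, mul_smul_comm]

lemma apply_eq_of_mem_sliceTail {m : ℕ} {φ : (Fin n → ℍ[ℝ]) → ℍ[ℝ]} (hφ : φ ∈ sliceTail n m)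
    {p q : Fin n → ℍ[ℝ]} (hpq : ∀ h : Fin n, m ≤ (h : ℕ) → p h = q h) : φ p = φ q := by
  induction hφ using Submodule.span_induction with
  | mem φ h =>
    obtain ⟨K, c, hK, rfl⟩ := h
    simp only
    rw [orderedProd_congr fun k hk => hpq k (hK k hk)]
  | zero => rfl
  | add φ ψ _ _ h1 h2 => simp only [Pi.add_apply, h1, h2]
  | smul r φ _ h1 => simp only [Pi.smul_apply, h1]

/-- Ordered products are affine in each variable separately, so affine interpolation is exact in all
variables at once, with product weights. -/
lemma combination_of_mem_sliceTail {m : ℕ} {φ : (Fin n → ℍ[ℝ]) → ℍ[ℝ]}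
    (hφ : φ ∈ sliceTail n m) {ι : Type} [Fintype ι] (w : Fin n → ι → ℝ)
    (q : Fin n → ι → ℍ[ℝ]) (x : Fin n → ℍ[ℝ]) (hw : ∀ h, ∑ j, w h j = 1)
    (hq : ∀ h, ∑ j, w h j • q h j = x h) :
    φ x = ∑ r : Fin n → ι, (∏ h, w h (r h)) • φ fun h => q h (r h) := by
  induction hφ using Submodule.span_induction with
  | mem φ h =>
    obtain ⟨K, c, -, rfl⟩ := h
    simp only [orderedProd_combination w q x hw hq K, Finset.sum_mul, smul_mul_assoc]
  | zero => simp
  | add φ ψ _ _ h1 h2 => simp only [Pi.add_apply, h1, h2, smul_add, Finset.sum_add_distrib]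
  | smul r φ _ h1 => simp only [Pi.smul_apply, h1, Finset.smul_sum, smul_comm r]

lemma phi_eq (J : ℍ[ℝ]) (z : ℂ) : phi J z = z.re • 1 + z.im • J := by
  rw [phi, ← Quaternion.coe_mul_eq_smul z.re, mul_one]

/-- Functions in `sliceTail` restrict to slice functions on each torus. -/
lemma exists_stem_of_mem_sliceTail {m : ℕ} {φ : (Fin n → ℍ[ℝ]) → ℍ[ℝ]}
    (hφ : φ ∈ sliceTail n m) (z : Fin n → ℂ) : ∃ F : Finset (Fin n) → ℍ[ℝ],
      ∀ J : Fin n → ℍ[ℝ], φ (fun h => phi (J h) (z h)) = ∑ K, orderedProd J K * F K := by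
  induction hφ using Submodule.span_induction with
  | mem φ h =>
    obtain ⟨K, c, -, rfl⟩ := h
    obtain ⟨r, hr⟩ := orderedProd_affine (fun h => (z h).re) (fun h => (z h).im) K
    refine ⟨fun s => r s • c, fun J => ?_⟩
    have : (fun h => phi (J h) (z h)) = fun h => (z h).re • 1 + (z h).im • J h := by
      funext h
      exact phi_eq _ _
    simp only [this, hr, Finset.sum_mul, mul_smul_comm, smul_mul_assoc]
  | zero => exact ⟨0, by simp⟩
  | add φ ψ _ _ h1 h2 =>
    obtain ⟨F, h⟩ := h1
    obtain ⟨F', h'⟩ := h2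
    exact ⟨F + F', fun J => by simp [h, h', mul_add, Finset.sum_add_distrib]⟩
  | smul r φ _ h1 =>
    obtain ⟨F, h⟩ := h1
    exact ⟨r • F, fun J => by simp [h, Finset.smul_sum]⟩

/-- A slice function on a torus without real components is the restriction of a function
in `sliceTail`. -/
lemma exists_mem_sliceTail_of_stem (z : Fin n → ℂ) (hz : ∀ h, (z h).im ≠ 0)
    (F : Finset (Fin n) → ℍ[ℝ]) : ∃ φ ∈ sliceTail n 0,
      ∀ J : Fin n → ℍ[ℝ], φ (fun h => phi (J h) (z h)) = ∑ K, orderedProd J K * F K := by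
  -- The coefficients invert `x = α + Jβ` to `J = β⁻¹(x - α)`, which needs `β ≠ 0`.
  choose r hr using orderedProd_affine (fun h => -((z h).im⁻¹ * (z h).re)) (fun h => (z h).im⁻¹)
  refine ⟨∑ K, ∑ s, r K s • fun p => orderedProd p s * F K, ?_, fun J => ?_⟩
  · exact Submodule.sum_mem _ fun K _ => Submodule.sum_mem _ fun s _ => Submodule.smul_mem _ _
      (orderedProd_mul_mem_sliceTail (by simp) _)
  · simp only [Finset.sum_apply, Pi.smul_apply]
    refine Finset.sum_congr rfl fun K _ => ?_
    simp only [← smul_mul_assoc, ← Finset.sum_mul, ← hr]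
    congr 2
    funext h
    rw [phi_eq, smul_add, smul_smul, smul_smul, inv_mul_cancel₀ (hz h), one_smul, ← add_assoc,
      ← add_smul, neg_add_cancel, zero_smul, zero_add]

end

/-! ### The spherical Dirac operator: Leibniz rule, tangentiality, regularity. -/

section

lemma contDiff_of_isLinearMap {E : Type*} [NormedAddCommGroup E] [NormedSpace ℝ E]
    {φ : ℍ[ℝ] → E} (h : IsLinearMap ℝ φ) {k : WithTop ℕ∞} : ContDiff ℝ k φ :=
  (LinearMap.toContinuousLinearMap h.mk').contDiff

lemma contDiff_im {k : WithTop ℕ∞} : ContDiff ℝ k fun q : ℍ[ℝ] => q.im :=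
  contDiff_of_isLinearMap ⟨fun _ _ => Quaternion.im_add _ _, fun _ _ => Quaternion.im_smul _ _⟩

lemma contDiff_re {k : WithTop ℕ∞} : ContDiff ℝ k fun q : ℍ[ℝ] => q.re :=
  contDiff_of_isLinearMap ⟨fun _ _ => rfl, fun _ _ => rfl⟩

lemma contDiff_coord {k : WithTop ℕ∞} (i : Fin 3) : ContDiff ℝ k fun q : ℍ[ℝ] => coord q i := by
  fin_cases i <;> exact contDiff_of_isLinearMap ⟨fun _ _ => rfl, fun _ _ => rfl⟩

lemma contDiffAt_quaternion_inv {q : ℍ[ℝ]} (hq : q ≠ 0) {k : WithTop ℕ∞} :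
    ContDiffAt ℝ k (Inv.inv : ℍ[ℝ] → ℍ[ℝ]) q := by
  simpa only [Ring.inverse_eq_inv'] using! contDiffAt_ringInverse ℝ (Units.mk0 q hq) (n := k)

variable {n : ℕ}

lemma unit_re (j : Fin 3) : (unit j).re = 0 := by fin_cases j <;> rfl
lemma unit_zero_imI : (unit 0).imI = 1 := rfl
lemma unit_zero_imJ : (unit 0).imJ = 0 := rfl
lemma unit_zero_imK : (unit 0).imK = 0 := rfl
lemma unit_one_imI : (unit 1).imI = 0 := rfl
lemma unit_one_imJ : (unit 1).imJ = 1 := rfl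
lemma unit_one_imK : (unit 1).imK = 0 := rfl
lemma unit_two_imI : (unit 2).imI = 0 := rfl
lemma unit_two_imJ : (unit 2).imJ = 0 := rfl
lemma unit_two_imK : (unit 2).imK = 1 := rfl

attribute [local simp] unit_re unit_zero_imI unit_zero_imJ unit_zero_imK unit_one_imI
  unit_one_imJ unit_one_imK unit_two_imI unit_two_imJ unit_two_imK

/-- The direction tangent at `q` to the rotations of the sphere `𝕊_q` about `e_j`. -/
def rotDir (q : ℍ[ℝ]) (j : Fin 3) : ℍ[ℝ] := (2⁻¹ : ℝ) • (unit j * q - q * unit j)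

lemma rotDir_zero (q : ℍ[ℝ]) : rotDir q 0 = q.imJ • unit 2 - q.imK • unit 1 := by
  ext <;> simp [rotDir] <;> ring

lemma rotDir_one (q : ℍ[ℝ]) : rotDir q 1 = q.imK • unit 0 - q.imI • unit 2 := by
  ext <;> simp [rotDir] <;> ring

lemma rotDir_two (q : ℍ[ℝ]) : rotDir q 2 = q.imI • unit 1 - q.imJ • unit 0 := by
  ext <;> simp [rotDir] <;> ring

/-- Both `e_a e_b` (for `a ≠ b`) and `L_{ab}` are antisymmetric, so the double sum collapses to the
three infinitesimal rotations about the axes. -/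
lemma sphDirac_eq (m : Fin n) (f : (Fin n → ℍ[ℝ]) → ℍ[ℝ]) (x : Fin n → ℍ[ℝ]) :
    sphDirac m f x = -∑ j, unit j * fderiv ℝ f x (Pi.single m (rotDir (x m) j)) := by
  have hsub : ∀ (a b : ℝ) (u v : ℍ[ℝ]), fderiv ℝ f x (Pi.single m (a • u - b • v)) =
      a • fderiv ℝ f x (Pi.single m u) - b • fderiv ℝ f x (Pi.single m v) := by
    intro a b u v
    rw [Pi.single_sub, Pi.single_smul, Pi.single_smul, map_sub, map_smul, map_smul]
  simp only [sphDirac, tangential, pderiv, Fin.sum_univ_three, rotDir_zero, rotDir_one,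
    rotDir_two, hsub]
  generalize fderiv ℝ f x (Pi.single m (unit 0)) = a
  generalize fderiv ℝ f x (Pi.single m (unit 1)) = b
  generalize fderiv ℝ f x (Pi.single m (unit 2)) = c
  ext <;> simp [coord] <;> ring

lemma sum_unit_mul_rotDir (q : ℍ[ℝ]) : -∑ j, unit j * rotDir q j = 2 * q.im := by
  simp only [Fin.sum_univ_three, rotDir_zero, rotDir_one, rotDir_two, two_mul]
  ext <;> simp

/-- The Leibniz rule for the spherical Dirac operator and the `m`-th variable. -/
lemma sphDirac_mul (m : Fin n) {f : (Fin n → ℍ[ℝ]) → ℍ[ℝ]} {x : Fin n → ℍ[ℝ]}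
    (hf : DifferentiableAt ℝ f x) : sphDirac m (fun y => y m * f y) x =
      2 * (x m).im * f x + star (x m) * sphDirac m f x := by
  have hd : ∀ v, fderiv ℝ (fun y : Fin n → ℍ[ℝ] => y m * f y) x (Pi.single m v) =
      x m * fderiv ℝ f x (Pi.single m v) + v * f x := by
    intro v
    have h1 : HasFDerivAt (fun y : Fin n → ℍ[ℝ] => y m)
        (ContinuousLinearMap.proj (R := ℝ) (φ := fun _ : Fin n => ℍ[ℝ]) m) x :=
      hasFDerivAt_apply m x
    have h2 : HasFDerivAt (fun y : Fin n → ℍ[ℝ] => y m * f y) _ x := h1.mul' hf.hasFDerivAt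
    rw [h2.fderiv]
    simp
  have hsub : ∀ (a b : ℝ) (u v : ℍ[ℝ]), fderiv ℝ f x (Pi.single m (a • u - b • v)) =
      a • fderiv ℝ f x (Pi.single m u) - b • fderiv ℝ f x (Pi.single m v) := by
    intro a b u v
    rw [Pi.single_sub, Pi.single_smul, Pi.single_smul, map_sub, map_smul, map_smul]
  rw [sphDirac_eq, sphDirac_eq, ← sum_unit_mul_rotDir]
  simp only [hd, mul_add, Finset.sum_add_distrib, neg_add, neg_mul, Finset.sum_mul, mul_assoc]
  rw [add_comm]
  congr 1
  -- Since `e_j x = x̄ e_j - 2 x_j`, the identity rests on `∑ x_j ∂_{rotDir_j} f = 0`: rotation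
  -- about `Im x` fixes `x`. Expanding the directions in the basis `unit` lets `ring` see this.
  simp only [Fin.sum_univ_three, rotDir_zero, rotDir_one, rotDir_two, hsub]
  generalize fderiv ℝ f x (Pi.single m (unit 0)) = a
  generalize fderiv ℝ f x (Pi.single m (unit 1)) = b
  generalize fderiv ℝ f x (Pi.single m (unit 2)) = c
  generalize x m = q
  ext <;> simp <;> ring

/-- Through each point of `𝕊_q` there is a circle of `𝕊_q` with a given rotation direction. -/
lemma exists_circle (q : ℍ[ℝ]) (j : Fin 3) : ∃ a c : ℍ[ℝ], a + c = q ∧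
    ∀ t : ℝ, Real.cos t • a + Real.sin t • rotDir q j + c ∈ sphere q := by
  have key : ∀ p : ℍ[ℝ], p.re = q.re → p.imI ^ 2 + p.imJ ^ 2 + p.imK ^ 2 =
      q.imI ^ 2 + q.imJ ^ 2 + q.imK ^ 2 → p ∈ sphere q := by
    intro p h1 h2
    rw [← norm_im_sq, ← norm_im_sq] at h2
    exact mem_sphere_iff.2 ⟨h1, (pow_left_inj₀ (norm_nonneg _) (norm_nonneg _) two_ne_zero).1 h2⟩
  fin_cases j
  · refine ⟨q.imJ • unit 1 + q.imK • unit 2, (q.re : ℍ[ℝ]) + q.imI • unit 0,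
      by ext <;> simp, fun t => key _ ?_ ?_⟩
    · simp [rotDir_zero]
    · simp [rotDir_zero]
      linear_combination (q.imJ ^ 2 + q.imK ^ 2) * Real.sin_sq_add_cos_sq t
  · refine ⟨q.imI • unit 0 + q.imK • unit 2, (q.re : ℍ[ℝ]) + q.imJ • unit 1,
      by ext <;> simp, fun t => key _ ?_ ?_⟩
    · simp [rotDir_one]
    · simp [rotDir_one]
      linear_combination (q.imI ^ 2 + q.imK ^ 2) * Real.sin_sq_add_cos_sq t
  · refine ⟨q.imI • unit 0 + q.imJ • unit 1, (q.re : ℍ[ℝ]) + q.imK • unit 2,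
      by ext <;> simp, fun t => key _ ?_ ?_⟩
    · simp [rotDir_two]
    · simp [rotDir_two]
      linear_combination (q.imI ^ 2 + q.imJ ^ 2) * Real.sin_sq_add_cos_sq t

/-- The operator differentiates only along circles of the `m`-th sphere, so values of `f` on the
torus suffice. Along such a circle `A` and `B` do not vary, and `f` is affine in `x_m`. -/
lemma sphDirac_of_eqOn_torus (m : Fin n) {f A B : (Fin n → ℍ[ℝ]) → ℍ[ℝ]} {x : Fin n → ℍ[ℝ]}
    (hf : DifferentiableAt ℝ f x) (hA : A ∈ sliceTail n (m + 1)) (hB : B ∈ sliceTail n (m + 1))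
    (h : ∀ᶠ p in nhds x, p ∈ torus x → f p = A p + p m * B p) :
    sphDirac m f x = 2 * (x m).im * B x := by
  have key : ∀ j, fderiv ℝ f x (Pi.single m (rotDir (x m) j)) = rotDir (x m) j * B x := by
    intro j
    obtain ⟨a, c, hac, hmem⟩ := exists_circle (x m) j
    set γ : ℝ → ℍ[ℝ] := fun t => Real.cos t • a + Real.sin t • rotDir (x m) j + c with hγ
    have hγ0 : γ 0 = x m := by simp [hγ, hac]
    have hγ' : HasDerivAt γ (rotDir (x m) j) 0 := by
      have := (((Real.hasDerivAt_cos 0).smul_const a).add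
        ((Real.hasDerivAt_sin 0).smul_const (rotDir (x m) j))).add_const c
      simp only [Real.sin_zero, neg_zero, zero_smul, Real.cos_zero, one_smul, zero_add] at this
      exact this
    have hup : HasDerivAt (fun t => Function.update x m (γ t))
        (Pi.single m (rotDir (x m) j)) 0 := by
      rw [hasDerivAt_pi]
      intro k
      by_cases hk : k = m
      · subst hk
        simpa using hγ'
      · simpa [hk] using hasDerivAt_const (0 : ℝ) (x k)
    have hx0 : Function.update x m (γ 0) = x := by rw [hγ0, Function.update_eq_self]
    have h1 : HasDerivAt (fun t => f (Function.update x m (γ t)))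
        (fderiv ℝ f x (Pi.single m (rotDir (x m) j))) 0 := by
      refine HasFDerivAt.comp_hasDerivAt 0 ?_ hup
      rw [hx0]
      exact hf.hasFDerivAt
    have h2 : HasDerivAt (fun t => A x + γ t * B x) (rotDir (x m) j * B x) 0 :=
      (hγ'.mul_const (B x)).const_add (A x)
    have hev : (fun t => f (Function.update x m (γ t))) =ᶠ[nhds 0] fun t => A x + γ t * B x := by
      have hc : Filter.Tendsto (fun t => Function.update x m (γ t)) (nhds 0) (nhds x) := by
        have := hup.continuousAt.tendsto
        rwa [hx0] at this
      filter_upwards [hc.eventually h] with t ht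
      have hne : ∀ k : Fin n, (m : ℕ) + 1 ≤ k → Function.update x m (γ t) k = x k := by
        intro k hk
        rw [Function.update_of_ne]
        rintro rfl
        omega
      rw [ht, Function.update_self, apply_eq_of_mem_sliceTail hA hne,
        apply_eq_of_mem_sliceTail hB hne]
      intro k
      by_cases hk : k = m
      · subst hk
        simpa using hmem t
      · simpa [hk] using mem_torus_self x k
    exact h1.unique (h2.congr_of_eventuallyEq hev)
  rw [sphDirac_eq]
  simp only [key, ← mul_assoc, ← Finset.sum_mul]
  rw [← neg_mul, sum_unit_mul_rotDir]

lemma contDiffOn_sphDirac (m : Fin n) {f : (Fin n → ℍ[ℝ]) → ℍ[ℝ]} {W : Set (Fin n → ℍ[ℝ])}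
    (hW : IsOpen W) {k : ℕ} (hf : ContDiffOn ℝ (k + 1 : ℕ) f W) :
    ContDiffOn ℝ k (sphDirac m f) W := by
  have hd : ∀ j, ContDiffOn ℝ k (pderiv m j f) W := fun j =>
    (hf.fderiv_of_isOpen hW (by norm_cast)).clm_apply contDiffOn_const
  have hm : ContDiff ℝ k fun x : Fin n → ℍ[ℝ] => x m := contDiff_apply ℝ ℍ[ℝ] m
  have hc : ∀ i, ContDiffOn ℝ k (fun x : Fin n → ℍ[ℝ] => coord (x m) i) W := fun i =>
    ((contDiff_coord i).comp hm).contDiffOn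
  have ht : ∀ i j, ContDiffOn ℝ k (fun x => unit i * unit j * tangential m i j f x) W :=
    fun i j => contDiffOn_const.mul (((hc i).smul (hd j)).sub ((hc j).smul (hd i)))
  have hs : ContDiffOn ℝ k (fun x => ∑ i, ∑ j, unit i * unit j * tangential m i j f x) W :=
    ContDiffOn.sum fun i _ => ContDiffOn.sum fun j _ => ht i j
  exact hs.const_smul _

lemma gammaIter_succ (f : (Fin n → ℍ[ℝ]) → ℍ[ℝ]) (m : Fin n) (K : Finset (Fin n)) :
    gammaIter f (m + 1) K = fun x => (2 * (x m).im)⁻¹ *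
      sphDirac m (fun y => y m ^ (if m ∈ K then 1 else 0) * gammaIter f m (K.erase m) y) x := by
  funext x
  simp only [gammaIter, m.isLt, dif_pos, Fin.eta]

lemma two_mul_im_ne_zero {q : ℍ[ℝ]} (hq : q.im ≠ 0) : 2 * q.im ≠ 0 := by
  rw [two_mul, ← two_smul ℝ]
  exact smul_ne_zero two_ne_zero hq

/-- Each step costs one derivative, and `(2 Im x_m)⁻¹` is smooth off `ℝ_•`. Class `Cⁿ` thus leaves
at least one derivative before each of the `n` steps. -/
lemma contDiffOn_gammaIter {f : (Fin n → ℍ[ℝ]) → ℍ[ℝ]} {W : Set (Fin n → ℍ[ℝ])}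
    (hW : IsOpen W) (hWr : ∀ x ∈ W, x ∉ realLocus n) (hf : ContDiffOn ℝ n f W) (m : ℕ)
    (hm : m ≤ n) (K : Finset (Fin n)) : ContDiffOn ℝ (n - m : ℕ) (gammaIter f m K) W := by
  induction m generalizing K with
  | zero => exact hf
  | succ m ih =>
    have ih' := ih (by omega) (K.erase ⟨m, hm⟩)
    have hnm : n - m = n - (m + 1) + 1 := by omega
    rw [gammaIter_succ f ⟨m, hm⟩ K]
    have happ : ∀ k : WithTop ℕ∞, ContDiff ℝ k fun x : Fin n → ℍ[ℝ] => x ⟨m, hm⟩ :=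
      fun k => contDiff_apply ℝ ℍ[ℝ] _
    refine ContDiffOn.mul ?_ (contDiffOn_sphDirac _ hW ?_)
    · intro x hx
      refine ContDiffAt.contDiffWithinAt ?_
      refine ContDiffAt.comp x (contDiffAt_quaternion_inv
        (two_mul_im_ne_zero (notMem_realLocus.1 (hWr x hx) ⟨m, hm⟩))) ?_
      exact contDiffAt_const.mul (contDiff_im.comp (happ _)).contDiffAt
    · rw [← hnm]
      exact (((happ _).pow _).contDiffOn).mul ih'

lemma differentiableAt_gammaIter {f : (Fin n → ℍ[ℝ]) → ℍ[ℝ]} {W : Set (Fin n → ℍ[ℝ])}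
    (hW : IsOpen W) (hWr : ∀ x ∈ W, x ∉ realLocus n) (hf : ContDiffOn ℝ n f W) (m : Fin n)
    (K : Finset (Fin n)) {x : Fin n → ℍ[ℝ]} (hx : x ∈ W) :
    DifferentiableAt ℝ (gammaIter f m K) x := by
  refine ((contDiffOn_gammaIter hW hWr hf m m.isLt.le K).contDiffAt (hW.mem_nhds hx))
    |>.differentiableAt ?_
  have := m.isLt
  norm_cast
  omega

end

/-! ### Constancy of the `Γ^m_K` versus sliceness on tori. -/

section

variable {n : ℕ}

/-- On each torus without real components, `f` agrees with a slice function at the points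
of `U`. -/
def SliceOnTori (f : (Fin n → ℍ[ℝ]) → ℍ[ℝ]) (U : Set (Fin n → ℍ[ℝ])) : Prop :=
  ∀ y ∉ realLocus n, ∃ φ ∈ sliceTail n 0, ∀ p ∈ torus y ∩ U, f p = φ p

lemma star_eq_two_re_sub (q : ℍ[ℝ]) : star q = (2 * q.re) • 1 - q := by
  ext <;> simp
  ring

/-- Both factors lie in the commutative plane spanned by `1` and `Im q`. -/
lemma commute_inv_two_mul_im_star (q : ℍ[ℝ]) : Commute (2 * q.im)⁻¹ (star q) := by
  refine Commute.inv_left₀ ?_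
  rw [commute_iff_eq, two_mul]
  ext <;> simp <;> ring

lemma isOpen_diff_realLocus {U : Set (Fin n → ℍ[ℝ])} (hU : IsOpen U) :
    IsOpen (U \ realLocus n) := hU.sdiff isClosed_realLocus

lemma gammaIter_eq_sub {f : (Fin n → ℍ[ℝ]) → ℍ[ℝ]} (m : Fin n) {K : Finset (Fin n)}
    (hm : m ∉ K) {x : Fin n → ℍ[ℝ]} (hx : x ∉ realLocus n)
    (hd : DifferentiableAt ℝ (gammaIter f m K) x) :
    gammaIter f m K x = gammaIter f (m + 1) (insert m K) x -
      star (x m) * gammaIter f (m + 1) K x := by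
  have h0 := two_mul_im_ne_zero (notMem_realLocus.1 hx m)
  simp only [gammaIter_succ, Finset.mem_insert_self, if_true, pow_one, Finset.erase_insert hm,
    if_neg hm, pow_zero, one_mul, Finset.erase_eq_of_notMem hm]
  rw [sphDirac_mul m hd, mul_add, inv_mul_cancel_left₀ h0, ← mul_assoc, ← mul_assoc,
    (commute_inv_two_mul_im_star (x m)).eq, add_sub_cancel_right]

/-- Descending induction on `gammaIter_eq_sub`. On the torus `x̄_m` is the constant `2 Re y_m` minus
`x_m`, so each step down introduces just the variable `x_m`. -/
lemma exists_mem_sliceTail_of_gammaIter_const {f : (Fin n → ℍ[ℝ]) → ℍ[ℝ]}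
    {U : Set (Fin n → ℍ[ℝ])} (hU : IsOpen U) (hf : ContDiffOn ℝ n f (U \ realLocus n))
    {y : Fin n → ℍ[ℝ]} (hy : y ∉ realLocus n)
    (hconst : ∀ K, ∀ a ∈ torus y ∩ U, ∀ b ∈ torus y ∩ U, gammaIter f n K a = gammaIter f n K b)
    (m : ℕ) (hm : m ≤ n) : ∀ K : Finset (Fin n), (∀ k ∈ K, (k : ℕ) < m) →
      ∃ φ ∈ sliceTail n m, ∀ p ∈ torus y ∩ U, gammaIter f m K p = φ p := by
  induction hm using Nat.decreasingInduction with
  | self =>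
    intro K _
    by_cases hne : (torus y ∩ U).Nonempty
    · obtain ⟨a, ha⟩ := hne
      exact ⟨_, const_mem_sliceTail n (gammaIter f n K a), fun p hp => hconst K p hp a ha⟩
    · exact ⟨0, Submodule.zero_mem _, fun p hp => absurd ⟨p, hp⟩ hne⟩
  | of_succ m hm ih =>
    intro K hK
    obtain ⟨X, hX, hXf⟩ := ih K fun k hk => (hK k hk).trans (Nat.lt_succ_self m)
    obtain ⟨Y, hY, hYf⟩ := ih (insert ⟨m, hm⟩ K) (by
      simpa using fun k hk => (hK k hk).trans (Nat.lt_succ_self m))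
    have hmK : (⟨m, hm⟩ : Fin n) ∉ K := fun h => lt_irrefl m (hK _ h)
    refine ⟨Y - (2 * (y ⟨m, hm⟩).re) • X + fun p => p ⟨m, hm⟩ * X p,
      Submodule.add_mem _ (Submodule.sub_mem _ (sliceTail_le m hY)
        (Submodule.smul_mem _ _ (sliceTail_le m hX))) (mul_mem_sliceTail ⟨m, hm⟩ hX), ?_⟩
    intro p hp
    have hpr := notMem_realLocus_of_mem_torus hp.1 hy
    have hid := gammaIter_eq_sub ⟨m, hm⟩ hmK hpr (differentiableAt_gammaIter
      (isOpen_diff_realLocus hU) (fun x hx => hx.2) hf ⟨m, hm⟩ K ⟨hp.2, hpr⟩)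
    simp only at hid
    rw [hid, hXf p hp, hYf p hp, star_eq_two_re_sub, ((mem_torus_iff.1 hp.1) ⟨m, hm⟩).1]
    simp only [Pi.add_apply, Pi.sub_apply, Pi.smul_apply, sub_mul, smul_mul_assoc, one_mul]
    abel

lemma partialSphere_self (y : Fin n → ℍ[ℝ]) : partialSphere n y = torus y := by
  ext x
  exact ⟨fun h k => (h k).1 k.isLt, fun h k => ⟨fun _ => h k, fun hk => absurd k.isLt hk.not_gt⟩⟩

lemma sphere_self_mem (q : ℍ[ℝ]) : q ∈ sphere q := mem_sphere_iff.2 ⟨rfl, rfl⟩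

lemma partialSphere_subset_torus (m : ℕ) (y : Fin n → ℍ[ℝ]) : partialSphere m y ⊆ torus y := by
  intro x h k
  rcases lt_or_ge (k : ℕ) m with hk | hk
  · exact (h k).1 hk
  · rw [(h k).2 hk]
    exact sphere_self_mem _

/-- Only the top level `m = n` is needed. The centre `y` of a torus may lie outside `U`, so the
hypothesis is applied at a point of the trace instead. -/
lemma SliceOnTori.of_gammaIter_const {f : (Fin n → ℍ[ℝ]) → ℍ[ℝ]}
    {U : Set (Fin n → ℍ[ℝ])} (hU : IsOpen U) (hf : ContDiffOn ℝ n f (U \ realLocus n))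
    (h : ∀ y ∈ U \ realLocus n, ∀ K, ∀ a ∈ torus y ∩ U, ∀ b ∈ torus y ∩ U,
      gammaIter f n K a = gammaIter f n K b) : SliceOnTori f U := by
  intro y hy
  refine exists_mem_sliceTail_of_gammaIter_const hU hf hy (fun K a ha b hb => ?_) 0
    (Nat.zero_le n) ∅ (by simp)
  exact h a ⟨ha.2, notMem_realLocus_of_mem_torus ha.1 hy⟩ K a ⟨mem_torus_self a, ha.2⟩ b
    ⟨mem_torus_trans hb.1 (mem_torus_symm ha.1), hb.2⟩

lemma StronglySlice.sliceOnTori {f : (Fin n → ℍ[ℝ]) → ℍ[ℝ]} (hn : 1 ≤ n)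
    {U : Set (Fin n → ℍ[ℝ])} (hU : IsOpen U) (hf : ContDiffOn ℝ n f (U \ realLocus n))
    (h : StronglySlice f U) : SliceOnTori f U := by
  refine SliceOnTori.of_gammaIter_const hU hf fun y hy K => ?_
  rw [← partialSphere_self]
  exact h y hy n hn le_rfl K fun k _ => k.isLt

/-- If level `m` is `A + x_m B` on the torus, level `m + 1` is `B` when `m ∉ K`, and `A + x_m B +
x̄_m B = A + 2 Re(y_m) B` when `m ∈ K`; either way `x_m` has disappeared. -/
lemma gammaIter_mem_sliceTail {f : (Fin n → ℍ[ℝ]) → ℍ[ℝ]}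
    {U : Set (Fin n → ℍ[ℝ])} (hU : IsOpen U) (hf : ContDiffOn ℝ n f (U \ realLocus n))
    (h : SliceOnTori f U) {y : Fin n → ℍ[ℝ]} (hy : y ∉ realLocus n) (m : ℕ) (hm : m ≤ n)
    (K : Finset (Fin n)) :
    ∃ φ ∈ sliceTail n m, ∀ p ∈ torus y ∩ U, gammaIter f m K p = φ p := by
  induction m generalizing K with
  | zero => exact h y hy
  | succ m ih =>
    obtain ⟨φ, hφ, hφf⟩ := ih (by omega) (K.erase ⟨m, hm⟩)
    obtain ⟨A, hA, B, hB, hAB⟩ := exists_eq_add_mul_of_mem_sliceTail ⟨m, hm⟩ hφ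
    have key : ∀ p ∈ torus y ∩ U, sphDirac ⟨m, hm⟩ (gammaIter f m (K.erase ⟨m, hm⟩)) p =
        2 * (p ⟨m, hm⟩).im * B p := by
      intro p hp
      refine sphDirac_of_eqOn_torus ⟨m, hm⟩ (differentiableAt_gammaIter
        (isOpen_diff_realLocus hU) (fun x hx => hx.2) hf ⟨m, hm⟩ _
          ⟨hp.2, notMem_realLocus_of_mem_torus hp.1 hy⟩) hA hB ?_
      filter_upwards [hU.mem_nhds hp.2] with q hq hqp
      rw [← hAB, hφf q ⟨mem_torus_trans hqp hp.1, hq⟩]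
    have h0 : ∀ p ∈ torus y ∩ U, 2 * (p ⟨m, hm⟩).im ≠ 0 := fun p hp =>
      two_mul_im_ne_zero (notMem_realLocus.1 (notMem_realLocus_of_mem_torus hp.1 hy) _)
    rw [gammaIter_succ f ⟨m, hm⟩ K]
    by_cases hmK : (⟨m, hm⟩ : Fin n) ∈ K
    · refine ⟨A + (2 * (y ⟨m, hm⟩).re) • B,
        Submodule.add_mem _ hA (Submodule.smul_mem _ _ hB), fun p hp => ?_⟩
      simp only [if_pos hmK, pow_one]
      rw [sphDirac_mul _ (differentiableAt_gammaIter (isOpen_diff_realLocus hU)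
        (fun x hx => hx.2) hf ⟨m, hm⟩ _ ⟨hp.2, notMem_realLocus_of_mem_torus hp.1 hy⟩),
        key p hp, mul_add, inv_mul_cancel_left₀ (h0 p hp), ← mul_assoc _ (star _),
        (commute_inv_two_mul_im_star _).eq, mul_assoc (star _), inv_mul_cancel_left₀ (h0 p hp),
        star_eq_two_re_sub, ((mem_torus_iff.1 hp.1) ⟨m, hm⟩).1, hφf p hp, hAB]
      simp only [Pi.add_apply, Pi.smul_apply, sub_mul, smul_mul_assoc, one_mul]
      abel
    · refine ⟨B, hB, fun p hp => ?_⟩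
      simp only [if_neg hmK, pow_zero, one_mul]
      rw [key p hp, inv_mul_cancel_left₀ (h0 p hp)]

lemma SliceOnTori.stronglySlice {f : (Fin n → ℍ[ℝ]) → ℍ[ℝ]}
    {U : Set (Fin n → ℍ[ℝ])} (hU : IsOpen U) (hf : ContDiffOn ℝ n f (U \ realLocus n))
    (h : SliceOnTori f U) : StronglySlice f U := by
  intro y hy m _ hm K _ a ha b hb
  obtain ⟨φ, hφ, hφf⟩ := gammaIter_mem_sliceTail hU hf h hy.2 m hm K
  rw [hφf a ⟨partialSphere_subset_torus m y ha.1, ha.2⟩,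
    hφf b ⟨partialSphere_subset_torus m y hb.1, hb.2⟩]
  exact apply_eq_of_mem_sliceTail hφ fun k hk => by rw [(ha.1 k).2 hk, (hb.1 k).2 hk]

lemma neg_mem_imUnits {J : ℍ[ℝ]} (hJ : J ∈ imUnits) : -J ∈ imUnits := by
  have h : J * J = -1 := hJ
  have h' : -J * -J = -1 := by rw [neg_mul_neg, h]
  exact h'

lemma phi_conj (J : ℍ[ℝ]) (z : ℂ) : phi J ((starRingEnd ℂ) z) = phi (-J) z := by
  simp [phi]

lemma exists_phi_of_mem_sphere {J p : ℍ[ℝ]} {z : ℂ} (hJ : J ∈ imUnits)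
    (h : p ∈ sphere (phi J z)) : ∃ I ∈ imUnits, p = phi I z := by
  obtain ⟨w, ⟨I, hI, hw⟩, I', hI', rfl⟩ := h
  have hre : z.re = w.re := by rw [← phi_re J hJ, ← phi_re I hI, hw]
  have him : |z.im| = |w.im| := by rw [← norm_phi_im J hJ, ← norm_phi_im I hI, hw]
  rcases abs_eq_abs.1 him with h | h
  · exact ⟨I', hI', by rw [Complex.ext hre h]⟩
  -- Here `w` is the conjugate of `z`, which is absorbed by changing the sign of the unit.
  · refine ⟨-I', neg_mem_imUnits hI', ?_⟩
    rw [← phi_conj]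
    congr 1
    exact Complex.ext (by simp [hre]) (by simp [h])

lemma IsSliceOn.sliceOnTori {g : (Fin n → ℍ[ℝ]) → ℍ[ℝ]} {Ω : Set (Fin n → ℍ[ℝ])}
    (h : IsSliceOn g Ω) : SliceOnTori g Ω := by
  obtain ⟨D, F, -, rfl, -, hF⟩ := h
  intro y hy
  by_cases hne : (torus y ∩ circularSet D).Nonempty
  · obtain ⟨p, hp, z, hz, J, hJ, rfl⟩ := hne
    have hz0 : ∀ k, (z k).im ≠ 0 := by
      intro k hk
      refine notMem_realLocus.1 (notMem_realLocus_of_mem_torus hp hy) k ?_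
      rw [phi_im, hk, zero_smul]
    obtain ⟨φ, hφ, hφF⟩ := exists_mem_sliceTail_of_stem z hz0 (F z)
    refine ⟨φ, hφ, fun q hq => ?_⟩
    have hq' := mem_torus_trans hq.1 (mem_torus_symm hp)
    choose I hI hqI using fun k => exists_phi_of_mem_sphere (hJ k) (hq' k)
    rw [show q = fun k => phi (I k) (z k) from funext hqI, hφF, hF z hz I hI]
  · exact ⟨0, Submodule.zero_mem _, fun p hp => absurd ⟨p, hp⟩ hne⟩

lemma IsSliceExtension.sliceOnTori {f g : (Fin n → ℍ[ℝ]) → ℍ[ℝ]} {U : Set (Fin n → ℍ[ℝ])}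
    (h : IsSliceExtension f U g) : SliceOnTori f U := by
  intro y hy
  obtain ⟨φ, hφ, hφg⟩ := h.slice.sliceOnTori y hy
  refine ⟨φ, hφ, fun p hp => ?_⟩
  rw [← h.eqOn hp.2, hφg p ⟨hp.1, subset_symmCompletion U hp.2⟩]

end

/-! ### Bases of `ℍ` of the form `1 + J` with `J` near a given unit. -/

section

lemma unit_mem_imUnits (j : Fin 3) : unit j ∈ imUnits := by
  have h := norm_im_sq (unit j)
  rw [mem_imUnits_iff]
  refine ⟨unit_re j, (pow_eq_one_iff_of_nonneg (norm_nonneg _) two_ne_zero).1 ?_⟩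
  rw [h]
  fin_cases j <;> simp [unit]

/-- Rotation of an imaginary unit `J` about the axis `u`, parametrised rationally. -/
lemma rotate_mem_imUnits {J u : ℍ[ℝ]} (hJ : J ∈ imUnits) (hu : u ∈ imUnits) (t : ℝ) :
    (1 + t ^ 2)⁻¹ • (J + t • (u * J - J * u) - t ^ 2 • (u * J * u)) ∈ imUnits := by
  have hs : (1 + t ^ 2 : ℝ) ≠ 0 := by positivity
  have hu' : u * u = -1 := hu
  have hJ' : J * J = -1 := hJ
  -- Up to the factor `1 + t ^ 2`, this is conjugation by `1 + tu`, whose inverse is `(1 - tu) / (1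
  -- + t²)`.
  have h1 : J + t • (u * J - J * u) - t ^ 2 • (u * J * u) = (1 + t • u) * J * (1 - t • u) := by
    simp only [add_mul, mul_sub, one_mul, mul_one, smul_mul_assoc, mul_smul_comm, smul_smul,
      smul_sub, smul_add, sq]
    abel
  have h2 : (1 - t • u) * (1 + t • u) = (1 + t ^ 2) • (1 : ℍ[ℝ]) := by
    simp only [sub_mul, mul_add, one_mul, mul_one, smul_mul_assoc, mul_smul_comm, hu', smul_neg]
    module
  have h3 : (1 + t • u) * (1 - t • u) = (1 + t ^ 2) • (1 : ℍ[ℝ]) := by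
    simp only [add_mul, mul_sub, one_mul, mul_one, smul_mul_assoc, mul_smul_comm, hu', smul_neg]
    module
  rw [h1]
  have h4 : (1 + t • u) * J * (1 - t • u) * ((1 + t • u) * J * (1 - t • u)) =
      -((1 + t ^ 2) • ((1 + t ^ 2) • (1 : ℍ[ℝ]))) := by
    calc _ = (1 + t • u) * J * ((1 - t • u) * (1 + t • u)) * J * (1 - t • u) := by noncomm_ring
      _ = (1 + t ^ 2) • ((1 + t • u) * (J * J) * (1 - t • u)) := by
        rw [h2]
        simp only [mul_smul_comm, smul_mul_assoc, mul_one, mul_assoc]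
      _ = _ := by
        rw [hJ', mul_neg_one, neg_mul, h3, smul_neg]
  have h5 : ((1 + t ^ 2)⁻¹ • ((1 + t • u) * J * (1 - t • u))) *
      ((1 + t ^ 2)⁻¹ • ((1 + t • u) * J * (1 - t • u))) = -1 := by
    rw [smul_mul_smul_comm, h4, smul_neg, smul_smul, smul_smul]
    rw [show (1 + t ^ 2)⁻¹ * (1 + t ^ 2)⁻¹ * (1 + t ^ 2) * (1 + t ^ 2) = 1 by field_simp, one_smul]
  exact h5

/-- This is twice the orthogonal projection of `q` to the plane of `1` and `J`: that plane commutes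
with `J`, its orthogonal complement anticommutes. -/
lemma sub_mul_mul_self {J : ℍ[ℝ]} (hJ : J ∈ imUnits) (q : ℍ[ℝ]) :
    q - J * q * J = (2 * q.re) • 1 +
      (2 * (q.imI * J.imI + q.imJ * J.imJ + q.imK * J.imK)) • J := by
  obtain ⟨h0, h1⟩ := mem_imUnits_iff.1 hJ
  have h2 : J.imI ^ 2 + J.imJ ^ 2 + J.imK ^ 2 = 1 := by rw [← norm_im_sq, h1, one_pow]
  ext
  · simp [h0]
    linear_combination q.re * h2
  · simp [h0]
    linear_combination (-q.imI) * h2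
  · simp [h0]
    linear_combination (-q.imJ) * h2
  · simp [h0]
    linear_combination (-q.imK) * h2

/-- Small rotations of `J₀` stay in `N`. Cleared of denominators they are quadratic in the
parameter, so the values at `t`, `-t` and `0` place the coefficients of `t` and `t²` in the span.
Adding `1` turns affine combinations of units into linear ones. -/
lemma span_one_add_imUnits {J₀ : ℍ[ℝ]} (hJ₀ : J₀ ∈ imUnits) {N : Set ℍ[ℝ]} (hN : N ∈ nhds J₀) :
    Submodule.span ℝ {q : ℍ[ℝ] | ∃ J ∈ imUnits, J ∈ N ∧ q = 1 + J} = ⊤ := by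
  set S := Submodule.span ℝ {q : ℍ[ℝ] | ∃ J ∈ imUnits, J ∈ N ∧ q = 1 + J} with hS
  have hmem : ∀ J ∈ imUnits, J ∈ N → 1 + J ∈ S := fun J h1 h2 =>
    Submodule.subset_span ⟨J, h1, h2, rfl⟩
  have hJS : 1 + J₀ ∈ S := hmem _ hJ₀ (mem_of_mem_nhds hN)
  have hrot : ∀ u ∈ imUnits, u * J₀ - J₀ * u ∈ S ∧ 1 - u * J₀ * u ∈ S := by
    intro u hu
    set R : ℝ → ℍ[ℝ] := fun t =>
      (1 + t ^ 2)⁻¹ • (J₀ + t • (u * J₀ - J₀ * u) - t ^ 2 • (u * J₀ * u)) with hR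
    have hcont : Continuous R := by
      have : ∀ t : ℝ, 1 + t ^ 2 ≠ 0 := fun t => by positivity
      rw [hR]
      fun_prop (disch := assumption)
    have hR0 : R 0 = J₀ := by simp [hR]
    have hev : ∀ᶠ t in nhds (0 : ℝ), R t ∈ N ∧ R (-t) ∈ N := by
      refine Filter.Eventually.and (hcont.continuousAt.eventually_mem (by rwa [hR0])) ?_
      refine (hcont.comp continuous_neg).continuousAt.eventually_mem ?_
      simpa [hR0] using hN
    obtain ⟨t, ⟨h1, h2⟩, ht⟩ :=
      ((hev.filter_mono nhdsWithin_le_nhds).and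
        (self_mem_nhdsWithin : {(0 : ℝ)}ᶜ ∈ nhdsWithin 0 {0}ᶜ)).exists
    have ht0 : t ≠ 0 := ht
    have hs : (1 + t ^ 2 : ℝ) ≠ 0 := by positivity
    have hp : (1 + t ^ 2) • (1 : ℍ[ℝ]) + (J₀ + t • (u * J₀ - J₀ * u) - t ^ 2 • (u * J₀ * u)) ∈ S := by
      have := S.smul_mem (1 + t ^ 2) (hmem _ (rotate_mem_imUnits hJ₀ hu t) h1)
      rwa [smul_add, smul_inv_smul₀ hs] at this
    have hm : (1 + t ^ 2) • (1 : ℍ[ℝ]) + (J₀ - t • (u * J₀ - J₀ * u) - t ^ 2 • (u * J₀ * u)) ∈ S := by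
      have := S.smul_mem (1 + (-t) ^ 2) (hmem _ (rotate_mem_imUnits hJ₀ hu (-t)) h2)
      rwa [smul_add, neg_sq, smul_inv_smul₀ hs, neg_smul, ← sub_eq_add_neg] at this
    constructor
    · have := S.smul_mem (2 * t)⁻¹ (S.sub_mem hp hm)
      convert! this using 1
      have h2t : 2 * t ≠ 0 := mul_ne_zero two_ne_zero ht0
      rw [eq_inv_smul_iff₀ h2t, mul_smul, two_smul]
      abel
    · have := S.smul_mem (2 * t ^ 2)⁻¹ (S.sub_mem (S.add_mem hp hm) (S.smul_mem 2 hJS))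
      convert! this using 1
      have h2t : 2 * t ^ 2 ≠ 0 := mul_ne_zero two_ne_zero (pow_ne_zero _ ht0)
      rw [eq_inv_smul_iff₀ h2t, mul_smul, two_smul, two_smul, add_smul, one_smul, smul_sub]
      abel
  -- For imaginary `J₀`, the sum of `e J₀ e` over `e = i, j, k` is `J₀`. Adding `1 + J₀` then
  -- isolates `4 • 1`.
  have hsum : (3 : ℝ) • (1 : ℍ[ℝ]) - J₀ ∈ S := by
    have := S.sum_mem fun (j : Fin 3) (_ : j ∈ Finset.univ) => (hrot _ (unit_mem_imUnits j)).2
    convert! this using 1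
    have h0 := (mem_imUnits_iff.1 hJ₀).1
    rw [Fin.sum_univ_three]
    ext <;> simp [h0, unit_re, unit_zero_imI, unit_zero_imJ, unit_zero_imK, unit_one_imI,
      unit_one_imJ, unit_one_imK, unit_two_imI, unit_two_imJ, unit_two_imK]
    norm_num
  have h1S : (1 : ℍ[ℝ]) ∈ S := by
    have := S.smul_mem (4⁻¹ : ℝ) (S.add_mem hsum hJS)
    convert! this using 1
    rw [eq_inv_smul_iff₀ (by norm_num : (4 : ℝ) ≠ 0), show (4 : ℝ) = 3 + 1 by norm_num, add_smul,
      one_smul]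
    abel
  have hJ₀S : J₀ ∈ S := by simpa using S.sub_mem hJS h1S
  have hcomm : ∀ q : ℍ[ℝ], q * J₀ - J₀ * q ∈ S := by
    intro q
    have h := fun j => (hrot _ (unit_mem_imUnits j)).1
    have := S.add_mem (S.add_mem (S.smul_mem q.imI (h 0)) (S.smul_mem q.imJ (h 1)))
      (S.smul_mem q.imK (h 2))
    convert! this using 1
    ext <;> simp [unit_re, unit_zero_imI, unit_zero_imJ, unit_zero_imK, unit_one_imI,
      unit_one_imJ, unit_one_imK, unit_two_imI, unit_two_imJ, unit_two_imK] <;> ring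
  rw [eq_top_iff]
  intro q _
  -- The commutator of `J₀ q` with `J₀` is `J₀ q J₀ + q`; its sum with this element is `2q`.
  have h1 : q - J₀ * q * J₀ ∈ S := by
    rw [sub_mul_mul_self hJ₀]
    exact S.add_mem (S.smul_mem _ h1S) (S.smul_mem _ hJ₀S)
  have h2 := hcomm (J₀ * q)
  rw [← mul_assoc J₀ J₀ q, show J₀ * J₀ = -1 from hJ₀, neg_one_mul, sub_neg_eq_add] at h2
  have := S.smul_mem (2⁻¹ : ℝ) (S.add_mem h1 h2)
  convert! this using 1
  rw [eq_inv_smul_iff₀ (by norm_num : (2 : ℝ) ≠ 0), two_smul]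
  abel

lemma exists_basis_one_add_imUnits {J₀ : ℍ[ℝ]} (hJ₀ : J₀ ∈ imUnits) {N : Set ℍ[ℝ]}
    (hN : N ∈ nhds J₀) : ∃ (b : Module.Basis (Fin 4) ℝ ℍ[ℝ]) (J : Fin 4 → ℍ[ℝ]),
      ∀ j, J j ∈ imUnits ∧ J j ∈ N ∧ b j = 1 + J j := by
  have hsp := (span_one_add_imUnits hJ₀ hN).ge
  let b₀ := Module.Basis.ofSpan hsp
  let e := b₀.indexEquiv (Module.finBasisOfFinrankEq ℝ ℍ[ℝ] Quaternion.finrank_eq_four)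
  have hb : ∀ j, ∃ J ∈ imUnits, J ∈ N ∧ b₀.reindex e j = 1 + J := by
    intro j
    rw [Module.Basis.reindex_apply]
    exact Module.Basis.ofSpan_subset hsp ⟨_, rfl⟩
  choose J hJ using hb
  exact ⟨b₀.reindex e, J, hJ⟩

end

/-! ### Interpolation from nodes in `U`, and uniqueness of the extension. -/

section

lemma continuous_toComplex : Continuous toComplex := by
  have h : Continuous fun q : ℍ[ℝ] => (⟨q.re, ‖q.im‖⟩ : ℝ × ℝ) :=
    Quaternion.continuous_re.prodMk Quaternion.continuous_im.norm
  exact Complex.equivRealProdCLM.symm.continuous.comp h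

lemma continuous_phi (J : ℍ[ℝ]) : Continuous (phi J) := by
  have h : phi J = fun z : ℂ => z.re • (1 : ℍ[ℝ]) + z.im • J := funext fun z => phi_eq J z
  rw [h]
  exact (Complex.continuous_re.smul continuous_const).add
    (Complex.continuous_im.smul continuous_const)

lemma continuous_phi_left (z : ℂ) : Continuous fun J => phi J z :=
  continuous_const.add (continuous_const_smul z.im)

lemma contDiffAt_norm_im {q : ℍ[ℝ]} (hq : q.im ≠ 0) {k : WithTop ℕ∞} :
    ContDiffAt ℝ k (fun q : ℍ[ℝ] => ‖q.im‖) q :=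
  contDiff_im.contDiffAt.norm ℝ hq

lemma phi_toComplex_mem_sphere {J : ℍ[ℝ]} (hJ : J ∈ imUnits) (q : ℍ[ℝ]) :
    phi J (toComplex q) ∈ sphere q := by
  rw [mem_sphere_iff, phi_re J hJ, norm_phi_im J hJ]
  simp [toComplex]

/-- Near a point `q₁` of the sphere of `q₀`, every quaternion is an affine combination of points
of its own sphere that are close to `q₀`. -/
lemma exists_nodes {q₀ q₁ : ℍ[ℝ]} (h : q₁ ∈ sphere q₀) {W : Set ℍ[ℝ]} (hW : IsOpen W)
    (h0 : q₀ ∈ W) : ∃ V, IsOpen V ∧ q₁ ∈ V ∧ ∃ (w : Fin 4 → ℍ[ℝ] → ℝ) (p : Fin 4 → ℍ[ℝ] → ℍ[ℝ]),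
      (∀ j, ContinuousOn (w j) V ∧ ContinuousOn (p j) V) ∧
      (∀ q ∈ V, q.im ≠ 0 → ∀ (k : ℕ) j, ContDiffAt ℝ k (w j) q ∧ ContDiffAt ℝ k (p j) q) ∧
      ∀ q ∈ V, ∑ j, w j q = 1 ∧ ∑ j, w j q • p j q = q ∧ ∀ j, p j q ∈ sphere q ∧ p j q ∈ W := by
  by_cases hq : q₀.im = 0
  · have h1 : q₁ = q₀ := by
      obtain ⟨hre, him⟩ := mem_sphere_iff.1 h
      rw [hq, norm_zero, norm_eq_zero] at him
      rw [← Quaternion.re_add_im q₁, ← Quaternion.re_add_im q₀, hre, him, hq]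
    -- At a real component the sphere is a point, and `q` itself serves as its only effective node.
    refine ⟨W, hW, h1 ▸ h0, fun j _ => if j = 0 then 1 else 0, fun _ q => q,
      fun j => ⟨continuousOn_const, continuousOn_id⟩,
      fun q _ _ k j => ⟨contDiffAt_const, contDiffAt_id⟩, fun q hq => ⟨by simp, by simp,
        fun j => ⟨sphere_self_mem q, hq⟩⟩⟩
  · have hN : {J | phi J (toComplex q₀) ∈ W} ∈ nhds (imUnit q₀) := by
      refine (hW.preimage (continuous_phi_left (toComplex q₀))).mem_nhds ?_
      simpa [phi_toComplex] using h0
    obtain ⟨b, J, hJ⟩ := exists_basis_one_add_imUnits (imUnit_mem q₀) hN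
    have hpc : ∀ j, Continuous fun q => phi (J j) (toComplex q) := fun j =>
      (continuous_phi (J j)).comp continuous_toComplex
    have hws : ∀ q : ℍ[ℝ], q.im ≠ 0 → ∀ (k : WithTop ℕ∞) j,
        ContDiffAt ℝ k (fun q : ℍ[ℝ] => b.coord j (1 + ‖q.im‖⁻¹ • q.im)) q := by
      intro q hq k j
      have h1 : ContDiffAt ℝ k (fun q : ℍ[ℝ] => 1 + ‖q.im‖⁻¹ • q.im) q :=
        contDiffAt_const.add (((contDiffAt_norm_im hq).inv (norm_ne_zero_iff.2 hq)).smul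
          contDiff_im.contDiffAt)
      exact (contDiff_of_isLinearMap (b.coord j).isLinear).contDiffAt.comp q h1
    refine ⟨{q | q.im ≠ 0} ∩ ⋂ j, (fun q => phi (J j) (toComplex q)) ⁻¹' W, ?_, ?_,
      fun j q => b.coord j (1 + ‖q.im‖⁻¹ • q.im), fun j q => phi (J j) (toComplex q), ?_, ?_, ?_⟩
    · exact (isOpen_ne_fun Quaternion.continuous_im continuous_const).inter
        (isOpen_iInter_of_finite fun j => hW.preimage (hpc j))
    · obtain ⟨hre, him⟩ := mem_sphere_iff.1 h
      constructor
      · intro h1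
        rw [h1, norm_zero, eq_comm, norm_eq_zero] at him
        exact hq him
      · rw [Set.mem_iInter]
        intro j
        have : toComplex q₁ = toComplex q₀ := by rw [toComplex, hre, him, toComplex]
        rw [Set.mem_preimage, this]
        exact (hJ j).2.1
    · exact fun j => ⟨fun q hq => (hws q hq.1 0 j).continuousAt.continuousWithinAt,
        (hpc j).continuousOn⟩
    · intro q hq him k j
      refine ⟨hws q him k j, ?_⟩
      simp only [phi_eq, toComplex]
      exact (contDiff_re.contDiffAt.smul contDiffAt_const).add
        ((contDiffAt_norm_im him).smul contDiffAt_const)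
    · intro q hq
      -- The real part of this expansion says that the weights add up to one; what is left writes
      -- the unit of `q` as a combination of the `J j`.
      have hsum : ∑ j, b.coord j (1 + ‖q.im‖⁻¹ • q.im) • (1 + J j) = 1 + ‖q.im‖⁻¹ • q.im := by
        simpa only [fun j => (hJ j).2.2, Module.Basis.coord_apply] using
          b.sum_repr (1 + ‖q.im‖⁻¹ • q.im)
      simp only
      generalize hw : (fun j => b.coord j (1 + ‖q.im‖⁻¹ • q.im)) = w
      simp only [fun j => congrFun hw j] at hsum ⊢
      have h1 : ∑ j, w j = 1 := by
        have hre := congrArg (IsLinearMap.mk' (R := ℝ) (fun q : ℍ[ℝ] => q.re)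
          ⟨fun _ _ => rfl, fun _ _ => rfl⟩) hsum
        simpa [map_sum, fun j => (mem_imUnits_iff.1 (hJ j).1).1] using hre
      have h2 : ∑ j, w j • J j = ‖q.im‖⁻¹ • q.im := by
        simp only [smul_add, Finset.sum_add_distrib, ← Finset.sum_smul, h1, one_smul] at hsum
        exact add_left_cancel hsum
      refine ⟨h1, ?_, fun j => ⟨phi_toComplex_mem_sphere (hJ j).1 q, Set.mem_iInter.1 hq.2 j⟩⟩
      simp only [phi_eq, toComplex, smul_add, Finset.sum_add_distrib, ← Finset.sum_smul, h1,
        one_smul, smul_comm (w _) ‖q.im‖, ← Finset.smul_sum, h2]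
      rw [smul_inv_smul₀ (norm_ne_zero_iff.2 hq.1), ← Quaternion.coe_mul_eq_smul, mul_one]
      exact Quaternion.re_add_im q

variable {n : ℕ}

/-- Near a point of the symmetric completion of `U`, slice functions are interpolated from their
values on `U`. -/
lemma exists_interpolation {U : Set (Fin n → ℍ[ℝ])} (hU : IsOpen U) {x₁ : Fin n → ℍ[ℝ]}
    (hx₁ : x₁ ∈ symmCompletion U) : ∃ V, IsOpen V ∧ x₁ ∈ V ∧
      ∃ (w : (Fin n → Fin 4) → (Fin n → ℍ[ℝ]) → ℝ)
        (P : (Fin n → Fin 4) → (Fin n → ℍ[ℝ]) → (Fin n → ℍ[ℝ])),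
        (∀ r, ContinuousOn (w r) V ∧ ContinuousOn (P r) V) ∧
        (∀ x ∈ V \ realLocus n, ∀ (k : ℕ) r,
          ContDiffAt ℝ k (w r) x ∧ ContDiffAt ℝ k (P r) x) ∧
        (∀ x ∈ V, ∀ r, P r x ∈ torus x ∩ U) ∧
        ∀ x ∈ V, ∀ φ ∈ sliceTail n 0, φ x = ∑ r, w r x • φ (P r x) := by
  obtain ⟨y, hy, hxy⟩ := hx₁
  obtain ⟨ε, hε, hball⟩ := Metric.isOpen_iff.1 hU y hy
  choose V hVo hVx w p hc hd hs using fun h =>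
    exists_nodes (hxy h) Metric.isOpen_ball (Metric.mem_ball_self hε (x := y h))
  refine ⟨Set.pi Set.univ V, isOpen_set_pi Set.finite_univ fun h _ => hVo h, fun h _ => hVx h,
    fun r x => ∏ h, w h (r h) (x h), fun r x h => p h (r h) (x h), ?_, ?_, ?_, ?_⟩
  · intro r
    have hev : ∀ h, Set.MapsTo (fun x : Fin n → ℍ[ℝ] => x h) (Set.pi Set.univ V) (V h) :=
      fun h x hx => hx h trivial
    exact ⟨continuousOn_finsetProd _ fun h _ =>
        (hc h (r h)).1.comp (continuous_apply h).continuousOn (hev h),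
      continuousOn_pi.2 fun h => (hc h (r h)).2.comp (continuous_apply h).continuousOn (hev h)⟩
  · intro x hx k r
    have hx0 := notMem_realLocus.1 hx.2
    have happ : ∀ h, ContDiffAt ℝ k (fun x : Fin n → ℍ[ℝ] => x h) x := fun h =>
      (contDiff_apply ℝ ℍ[ℝ] h).contDiffAt
    exact ⟨contDiffAt_prod fun h _ =>
        ContDiffAt.comp x (hd h (x h) (hx.1 h trivial) (hx0 h) k (r h)).1 (happ h),
      contDiffAt_pi.2 fun h =>
        ContDiffAt.comp x (hd h (x h) (hx.1 h trivial) (hx0 h) k (r h)).2 (happ h)⟩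
  · intro x hx r
    refine ⟨fun h => ((hs h (x h) (hx h trivial)).2.2 (r h)).1, hball ?_⟩
    rw [Metric.mem_ball, dist_pi_lt_iff hε]
    exact fun h => ((hs h (x h) (hx h trivial)).2.2 (r h)).2
  · intro x hx φ hφ
    exact combination_of_mem_sliceTail hφ (fun h j => w h j (x h)) (fun h j => p h j (x h)) x
      (fun h => (hs h (x h) (hx h trivial)).1) fun h => (hs h (x h) (hx h trivial)).2.1

/-- Every point close to `x` has an interpolation node in `U` on its own torus; any one of the nodes
will do. -/
lemma isOpen_symmCompletion {U : Set (Fin n → ℍ[ℝ])} (hU : IsOpen U) :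
    IsOpen (symmCompletion U) := by
  rw [isOpen_iff_mem_nhds]
  intro x hx
  obtain ⟨V, hV, hxV, w, P, -, -, hP, -⟩ := exists_interpolation hU hx
  filter_upwards [hV.mem_nhds hxV] with q hq
  exact ⟨_, (hP q hq fun _ => 0).2, mem_torus_symm (hP q hq fun _ => 0).1⟩

/-- Near a point of the symmetric completion of `U` there is a candidate for the slice extension
of `f`, given by interpolation. -/
lemma exists_local_extension {U : Set (Fin n → ℍ[ℝ])} (hU : IsOpen U)
    {f : (Fin n → ℍ[ℝ]) → ℍ[ℝ]} (hf : ContinuousOn f U)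
    (hf' : ContDiffOn ℝ n f (U \ realLocus n)) {x₁ : Fin n → ℍ[ℝ]}
    (hx₁ : x₁ ∈ symmCompletion U) : ∃ V, IsOpen V ∧ x₁ ∈ V ∧ ∃ h : (Fin n → ℍ[ℝ]) → ℍ[ℝ],
      ContinuousOn h V ∧ ContDiffOn ℝ n h (V \ realLocus n) ∧
      ∀ x ∈ V, ∀ φ ∈ sliceTail n 0, (∀ p ∈ torus x ∩ U, f p = φ p) → h x = φ x := by
  obtain ⟨V, hV, hxV, w, P, hc, hd, hP, hφ⟩ := exists_interpolation hU hx₁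
  refine ⟨V, hV, hxV, fun x => ∑ r, w r x • f (P r x), ?_, ?_, ?_⟩
  · exact continuousOn_finsetSum _ fun r _ =>
      (hc r).1.smul (hf.comp (hc r).2 fun x hx => (hP x hx r).2)
  · intro x hx
    refine ContDiffAt.contDiffWithinAt (ContDiffAt.sum fun r _ => (hd x hx n r).1.smul ?_)
    have hr := hP x hx.1 r
    refine ContDiffAt.comp x (hf'.contDiffAt ((isOpen_diff_realLocus hU).mem_nhds ?_))
      (hd x hx n r).2
    exact ⟨hr.2, notMem_realLocus_of_mem_torus hr.1 hx.2⟩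
  · intro x hx φ hmem hfφ
    rw [hφ x hx φ hmem]
    exact Finset.sum_congr rfl fun r _ => by rw [hfφ _ (hP x hx r)]

lemma symmCompletion_subset_closure {U : Set (Fin n → ℍ[ℝ])} (hU : IsOpen U) :
    symmCompletion U ⊆ closure (symmCompletion U \ realLocus n) :=
  dense_compl_realLocus.open_subset_closure_inter (isOpen_symmCompletion hU)

/-- Off `ℝ_•` the value of an extension is dictated by interpolation from `f`; the remaining points
follow by continuity and density. -/
lemma IsSliceExtension.eqOn_symmCompletion {U : Set (Fin n → ℍ[ℝ])} (hU : IsOpen U)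
    {f g₁ g₂ : (Fin n → ℍ[ℝ]) → ℍ[ℝ]} (hf : ContinuousOn f U)
    (hf' : ContDiffOn ℝ n f (U \ realLocus n)) (h₁ : IsSliceExtension f U g₁)
    (h₂ : IsSliceExtension f U g₂) : Set.EqOn g₁ g₂ (symmCompletion U) := by
  refine Set.EqOn.of_subset_closure (s := symmCompletion U \ realLocus n) ?_ h₁.continuousOn
    h₂.continuousOn Set.sdiff_subset (symmCompletion_subset_closure hU)
  intro x hx
  obtain ⟨V, -, hxV, h, -, -, hh⟩ := exists_local_extension hU hf hf' hx.1
  have key : ∀ g, IsSliceExtension f U g → g x = h x := by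
    intro g hg
    obtain ⟨φ, hφ, hφg⟩ := hg.slice.sliceOnTori x hx.2
    rw [hφg x ⟨mem_torus_self x, hx.1⟩, hh x hxV φ hφ]
    intro p hp
    rw [← hg.eqOn hp.2, hφg p ⟨hp.1, subset_symmCompletion U hp.2⟩]
  rw [key g₁ h₁, key g₂ h₂]

end

/-! ### Recovery of the stem function, and existence of the extension. -/

section

variable {n : ℕ}

/-- The sign attached to a Boolean. -/
def sgn (b : Bool) : ℝ := if b then -1 else 1

lemma sgn_xor (a b : Bool) : sgn (xor a b) = sgn a * sgn b := by
  cases a <;> cases b <;> simp [sgn]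

/-- The components of the stem function of `g`, computed from the values of `g` on the
points with imaginary units `±i`. -/
def stemComp (g : (Fin n → ℍ[ℝ]) → ℍ[ℝ]) (z : Fin n → ℂ) (L : Finset (Fin n)) : ℍ[ℝ] :=
  ((2 : ℝ) ^ n)⁻¹ • ∑ ε : Fin n → Bool, (∏ h ∈ L, sgn (ε h)) •
    ((orderedProd (fun _ => unitI) L)⁻¹ * g fun h => phi (sgn (ε h) • unitI) (z h))

lemma sgn_smul_mem_imUnits (b : Bool) {J : ℍ[ℝ]} (hJ : J ∈ imUnits) : sgn b • J ∈ imUnits := by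
  cases b
  · simpa [sgn] using hJ
  · simpa [sgn] using neg_mem_imUnits hJ

lemma orderedProd_smul (s : Fin n → ℝ) (J : Fin n → ℍ[ℝ]) (K : Finset (Fin n)) :
    orderedProd (fun h => s h • J h) K = (∏ h ∈ K, s h) • orderedProd J K := by
  have h1 : (∏ h ∈ K, s h) = ∏ h, if h ∈ K then s h else 1 := by simp
  rw [orderedProd_eq_mkPi, orderedProd_eq_mkPi, h1, ← MultilinearMap.map_smul_univ]
  congr 1
  funext h
  split_ifs <;> simp

lemma orderedProd_ne_zero {J : Fin n → ℍ[ℝ]} (hJ : ∀ h, J h ≠ 0) (K : Finset (Fin n)) :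
    orderedProd J K ≠ 0 := by
  rw [orderedProd, Ne, List.prod_eq_zero_iff, List.mem_ofFn]
  rintro ⟨h, hh⟩
  split_ifs at hh with hK
  · exact hJ h hh
  · exact one_ne_zero hh

/-- Orthogonality of the characters of `(ℤ/2)ⁿ`, obtained by factoring the sum over the coordinates.
-/
lemma sum_sgn_prod (K L : Finset (Fin n)) :
    ∑ ε : Fin n → Bool, (∏ h ∈ L, sgn (ε h)) * ∏ h ∈ K, sgn (ε h) =
      if K = L then (2 : ℝ) ^ n else 0 := by
  have h1 : ∀ ε : Fin n → Bool, (∏ h ∈ L, sgn (ε h)) * ∏ h ∈ K, sgn (ε h) =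
      ∏ h, (if h ∈ L then sgn (ε h) else 1) * (if h ∈ K then sgn (ε h) else 1) := by
    intro ε
    rw [Finset.prod_mul_distrib]
    simp
  have h2 : ∑ ε : Fin n → Bool, (∏ h ∈ L, sgn (ε h)) * ∏ h ∈ K, sgn (ε h) =
      ∏ h, ∑ b : Bool, (if h ∈ L then sgn b else 1) * (if h ∈ K then sgn b else 1) := by
    rw [Finset.prod_univ_sum, Fintype.piFinset_univ]
    exact Finset.sum_congr rfl fun ε _ => h1 ε
  rw [h2]
  split_ifs with hKL
  · subst hKL
    have : ∀ h : Fin n,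
        ∑ b : Bool, (if h ∈ K then sgn b else 1) * (if h ∈ K then sgn b else 1) = 2 := by
      intro h
      by_cases hK : h ∈ K
      · simp [hK, sgn]
        norm_num
      · simp [hK]
    rw [Finset.prod_congr rfl fun h _ => this h]
    simp
  · obtain ⟨h, hh⟩ : ∃ h, ¬(h ∈ K ↔ h ∈ L) := by
      by_contra hcon
      push Not at hcon
      exact hKL (Finset.ext hcon)
    refine Finset.prod_eq_zero (Finset.mem_univ h) ?_
    by_cases h1 : h ∈ K <;> by_cases h2 : h ∈ L <;> simp_all [sgn]

lemma unitI_ne_zero : unitI ≠ 0 := by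
  intro h
  have := congrArg (fun q : ℍ[ℝ] => q.imI) h
  exact one_ne_zero (α := ℝ) this

lemma stemComp_eq {g : (Fin n → ℍ[ℝ]) → ℍ[ℝ]} {z : Fin n → ℂ} {F : Finset (Fin n) → ℍ[ℝ]}
    (h : ∀ J : Fin n → ℍ[ℝ], (∀ h, J h ∈ imUnits) →
      g (fun h => phi (J h) (z h)) = ∑ K, orderedProd J K * F K) : stemComp g z = F := by
  funext L
  have h1 : ∀ ε : Fin n → Bool, g (fun h => phi (sgn (ε h) • unitI) (z h)) =
      ∑ K, (∏ h ∈ K, sgn (ε h)) • (orderedProd (fun _ => unitI) K * F K) := by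
    intro ε
    rw [h _ fun k => sgn_smul_mem_imUnits _ unitI_mem]
    refine Finset.sum_congr rfl fun K _ => ?_
    rw [orderedProd_smul, smul_mul_assoc]
  simp only [stemComp, h1, Finset.mul_sum, Finset.smul_sum, mul_smul_comm, smul_smul]
  rw [Finset.sum_comm]
  simp only [← Finset.sum_smul, ← Finset.mul_sum, sum_sgn_prod]
  rw [Finset.sum_eq_single L]
  · rw [if_pos rfl, inv_mul_cancel₀ (by positivity), one_smul,
      inv_mul_cancel_left₀ (orderedProd_ne_zero (fun _ => unitI_ne_zero) L)]
  · intro K _ hK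
    rw [if_neg hK, mul_zero, zero_smul]
  · simp

/-- The parity is built into the formula, for any `g`: conjugating `z_h` amounts to flipping the
sign `ε_h` in the sum. -/
lemma stemComp_conjAt (g : (Fin n → ℍ[ℝ]) → ℍ[ℝ]) (z : Fin n → ℂ) (L : Finset (Fin n))
    (h : Fin n) : stemComp g (conjAt h z) L = if h ∈ L then -stemComp g z L else stemComp g z L := by
  let τ : (Fin n → Bool) → (Fin n → Bool) := fun ε k => xor (ε k) (decide (k = h))
  have hτ : Function.Involutive τ := fun ε => by funext k; simp [τ]
  have hsgn : ∀ k, sgn (decide (k = h)) = if k = h then -1 else 1 := by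
    intro k
    simp [sgn]
  have hpoint : ∀ ε : Fin n → Bool, (fun k => phi (sgn (ε k) • unitI) (conjAt h z k)) =
      fun k => phi (sgn (τ ε k) • unitI) (z k) := by
    intro ε
    funext k
    simp only [τ, sgn_xor, hsgn, conjAt]
    by_cases hk : k = h
    · subst hk
      simp [phi_conj]
    · simp [hk]
  have hprod : ∀ ε : Fin n → Bool, ∏ k ∈ L, sgn (τ ε k) =
      (if h ∈ L then -1 else 1) * ∏ k ∈ L, sgn (ε k) := by
    intro ε
    simp only [τ, sgn_xor, hsgn, Finset.prod_mul_distrib, Finset.prod_ite_eq']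
    rw [mul_comm]
  have hsum : stemComp g (conjAt h z) L = ((2 : ℝ) ^ n)⁻¹ • ∑ ε : Fin n → Bool,
      ((if h ∈ L then (-1 : ℝ) else 1) * ∏ k ∈ L, sgn (ε k)) •
        ((orderedProd (fun _ => unitI) L)⁻¹ * g fun k => phi (sgn (ε k) • unitI) (z k)) := by
    rw [stemComp]
    congr 1
    refine Fintype.sum_equiv hτ.toPerm _ _ fun ε => ?_
    rw [hpoint, Function.Involutive.coe_toPerm, ← hprod, hτ]
  rw [hsum]
  split_ifs <;> simp [stemComp, neg_smul]

lemma dense_im_ne_zero_complex : Dense {z : Fin n → ℂ | ∀ h, (z h).im ≠ 0} := by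
  have h1 : Dense {z : ℂ | z.im ≠ 0} := by
    intro q
    rw [mem_closure_iff_seq_limit]
    by_cases hq : q.im = 0
    · refine ⟨fun k => q + (1 / ((k : ℝ) + 1)) • Complex.I, fun k => ?_, ?_⟩
      · have : (k : ℝ) + 1 ≠ 0 := by positivity
        change (q + (1 / ((k : ℝ) + 1)) • Complex.I).im ≠ 0
        rw [Complex.add_im, Complex.smul_im, Complex.I_im, hq, zero_add, smul_eq_mul, mul_one]
        exact one_div_ne_zero this
      · have := (tendsto_one_div_add_atTop_nhds_zero_nat (𝕜 := ℝ)).smul_const Complex.I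
        simpa using this.const_add q
    · exact ⟨fun _ => q, fun _ => hq, tendsto_const_nhds⟩
  have h2 : {z : Fin n → ℂ | ∀ h, (z h).im ≠ 0} =
      Set.pi Set.univ fun _ : Fin n => {z : ℂ | z.im ≠ 0} := by
    ext z
    simp
  rw [h2]
  exact dense_pi _ fun _ _ => h1

lemma continuous_phi_pi (J : Fin n → ℍ[ℝ]) :
    Continuous fun z : Fin n → ℂ => fun h => phi (J h) (z h) :=
  continuous_pi fun h => (continuous_phi (J h)).comp (continuous_apply h)

/-- A continuous function on an open symmetric set which is slice on every torus without real
components is a slice function. -/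
lemma isSliceOn_symmCompletion {U : Set (Fin n → ℍ[ℝ])} (hU : IsOpen U)
    {g : (Fin n → ℍ[ℝ]) → ℍ[ℝ]} (hg : ContinuousOn g (symmCompletion U))
    (h : ∀ y ∈ symmCompletion U, y ∉ realLocus n → ∃ φ ∈ sliceTail n 0, ∀ p ∈ torus y, g p = φ p) :
    IsSliceOn g (symmCompletion U) := by
  have hI : ∀ _ : Fin n, unitI ∈ imUnits := fun _ => unitI_mem
  set D : Set (Fin n → ℂ) := {z | (fun h => phi unitI (z h)) ∈ symmCompletion U} with hD
  have hDJ : ∀ z, z ∈ D → ∀ J : Fin n → ℍ[ℝ], (∀ h, J h ∈ imUnits) →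
      (fun h => phi (J h) (z h)) ∈ symmCompletion U := fun z hz J hJ =>
    mem_symmCompletion_of_mem_torus hz (phi_mem_torus z hJ hI)
  have hDopen : IsOpen D := (isOpen_symmCompletion hU).preimage (continuous_phi_pi fun _ => unitI)
  have hgJ : ∀ J : Fin n → ℍ[ℝ], (∀ h, J h ∈ imUnits) →
      ContinuousOn (fun z : Fin n → ℂ => g fun h => phi (J h) (z h)) D := fun J hJ =>
    hg.comp (continuous_phi_pi J).continuousOn fun z hz => hDJ z hz J hJ
  refine ⟨D, stemComp g, ?_, ?_, fun z _ K h => stemComp_conjAt g z K h, ?_⟩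
  · intro z hz h
    refine mem_symmCompletion_of_mem_torus hz ?_
    intro k
    by_cases hk : k = h
    · subst hk
      rw [mem_sphere_iff, phi_re _ unitI_mem, phi_re _ unitI_mem, norm_phi_im _ unitI_mem,
        norm_phi_im _ unitI_mem]
      simp [conjAt]
    · simp [conjAt, hk, sphere_self_mem]
  · ext x
    constructor
    · intro hx
      refine ⟨fun h => toComplex (x h), ?_, fun h => imUnit (x h), fun h => imUnit_mem _,
        funext fun h => (phi_toComplex _).symm⟩
      exact mem_symmCompletion_of_mem_torus hx fun h => phi_toComplex_mem_sphere unitI_mem (x h)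
    · rintro ⟨z, hz, J, hJ, rfl⟩
      exact hDJ z hz J hJ
  · intro z hz J hJ
    -- The hypothesis on tori is silent when some `z h` is real; there the slice formula is a limit,
    -- both sides being continuous in `z`.
    have hcl : D ⊆ closure (D ∩ {z | ∀ h, (z h).im ≠ 0}) :=
      dense_im_ne_zero_complex.open_subset_closure_inter hDopen
    refine Set.EqOn.of_subset_closure (f := fun z : Fin n → ℂ => g fun h => phi (J h) (z h))
      (g := fun z => ∑ K, orderedProd J K * stemComp g z K) ?_ (hgJ J hJ) ?_
      Set.inter_subset_left hcl hz
    · intro z hz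
      have hzr : (fun h => phi unitI (z h)) ∉ realLocus n := by
        rw [notMem_realLocus]
        intro h h0
        have := norm_phi_im unitI unitI_mem (z h)
        rw [h0, norm_zero, eq_comm, abs_eq_zero] at this
        exact hz.2 h this
      obtain ⟨φ, hφ, hφg⟩ := h _ hz.1 hzr
      obtain ⟨F, hF⟩ := exists_stem_of_mem_sliceTail hφ z
      have hgF : ∀ J : Fin n → ℍ[ℝ], (∀ h, J h ∈ imUnits) →
          g (fun h => phi (J h) (z h)) = ∑ K, orderedProd J K * F K := fun J hJ => by
        rw [hφg _ (phi_mem_torus z hJ hI), hF]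
      simp only
      rw [hgF J hJ, stemComp_eq hgF]
    · refine continuousOn_finsetSum _ fun K _ => continuousOn_const.mul ?_
      unfold stemComp
      have hε : ∀ ε : Fin n → Bool, ContinuousOn (fun z => (∏ h ∈ K, sgn (ε h)) •
          ((orderedProd (fun _ => unitI) K)⁻¹ * g fun h => phi (sgn (ε h) • unitI) (z h))) D :=
        fun ε => (continuousOn_const.mul (hgJ (fun h => sgn (ε h) • unitI)
          fun h => sgn_smul_mem_imUnits _ unitI_mem)).const_smul (∏ h ∈ K, sgn (ε h))
      exact (continuousOn_finsetSum Finset.univ fun ε _ => hε ε).const_smul ((2 : ℝ) ^ n)⁻¹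

lemma SliceOnTori.exists_isSliceExtension {U : Set (Fin n → ℍ[ℝ])} (hU : IsOpen U)
    {f : (Fin n → ℍ[ℝ]) → ℍ[ℝ]} (hf : ContinuousOn f U)
    (hf' : ContDiffOn ℝ n f (U \ realLocus n)) (h : SliceOnTori f U) :
    ∃ g, IsSliceExtension f U g := by
  classical
  choose! Φ hΦ hΦf using h
  set A := symmCompletion U \ realLocus n with hA
  -- The choices `Φ x` are unrelated for different `x`, but on `A` the diagonal value `Φ x x` agrees
  -- with every local interpolant. Hence it has limits at all points of the completion, real
  -- components included.
  set g := extendFrom A fun x => Φ x x with hg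
  have hlim : ∀ x ∈ symmCompletion U, ∀ V, IsOpen V → x ∈ V → ∀ k : (Fin n → ℍ[ℝ]) → ℍ[ℝ],
      ContinuousOn k V →
      (∀ x ∈ V, ∀ φ ∈ sliceTail n 0, (∀ p ∈ torus x ∩ U, f p = φ p) → k x = φ x) →
      Filter.Tendsto (fun x => Φ x x) (nhdsWithin x A) (nhds (k x)) := by
    intro x _ V hV hxV k hk hkφ
    have h1 : Filter.Tendsto k (nhdsWithin x A) (nhds (k x)) :=
      (hk.continuousAt (hV.mem_nhds hxV)).tendsto.mono_left nhdsWithin_le_nhds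
    refine h1.congr' ?_
    filter_upwards [self_mem_nhdsWithin, nhdsWithin_le_nhds (hV.mem_nhds hxV)] with q hqA hqV
    exact hkφ q hqV _ (hΦ q hqA.2) (hΦf q hqA.2)
  have hgk : ∀ x ∈ symmCompletion U, ∀ V, IsOpen V → x ∈ V → ∀ k : (Fin n → ℍ[ℝ]) → ℍ[ℝ],
      ContinuousOn k V →
      (∀ x ∈ V, ∀ φ ∈ sliceTail n 0, (∀ p ∈ torus x ∩ U, f p = φ p) → k x = φ x) →
      g x = k x := fun x hx V hV hxV k hk hkφ =>
    extendFrom_eq (symmCompletion_subset_closure hU hx) (hlim x hx V hV hxV k hk hkφ)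
  have hcont : ContinuousOn g (symmCompletion U) := by
    refine continuousOn_extendFrom (symmCompletion_subset_closure hU) fun x hx => ?_
    obtain ⟨V, hV, hxV, k, hk, -, hkφ⟩ := exists_local_extension hU hf hf' hx
    exact ⟨_, hlim x hx V hV hxV k hk hkφ⟩
  refine ⟨g, ?_, isSliceOn_symmCompletion hU hcont ?_, hcont, ?_⟩
  · intro x hx
    have hx' := subset_symmCompletion U hx
    refine extendFrom_eq (symmCompletion_subset_closure hU hx') ?_
    have h1 : Filter.Tendsto f (nhdsWithin x A) (nhds (f x)) :=
      (hf.continuousAt (hU.mem_nhds hx)).tendsto.mono_left nhdsWithin_le_nhds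
    refine h1.congr' ?_
    filter_upwards [self_mem_nhdsWithin, nhdsWithin_le_nhds (hU.mem_nhds hx)] with q hqA hqU
    exact hΦf q hqA.2 q ⟨mem_torus_self q, hqU⟩
  · intro y hy hyr
    refine ⟨Φ y, hΦ y hyr, fun p hp => ?_⟩
    have hpU := mem_symmCompletion_of_mem_torus hy hp
    obtain ⟨V, hV, hxV, k, hk, -, hkφ⟩ := exists_local_extension hU hf hf' hpU
    rw [hgk p hpU V hV hxV k hk hkφ]
    exact hkφ p hxV _ (hΦ y hyr) fun q hq => hΦf y hyr q ⟨mem_torus_trans hq.1 hp, hq.2⟩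
  · intro x hx
    obtain ⟨V, hV, hxV, k, hk, hk', hkφ⟩ := exists_local_extension hU hf hf' hx.1
    have hkx : ContDiffAt ℝ n k x :=
      hk'.contDiffAt ((isOpen_diff_realLocus hV).mem_nhds ⟨hxV, hx.2⟩)
    refine (hkx.congr_of_eventuallyEq ?_).contDiffWithinAt
    filter_upwards [hV.mem_nhds hxV, (isOpen_symmCompletion hU).mem_nhds hx.1] with q hqV hqU
    exact hgk q hqU V hV hqV k hk hkφ

end

/-! ### Connected traces of spheres on balls, and the local statement. -/

section

lemma norm_sq_eq (q : ℍ[ℝ]) : ‖q‖ ^ 2 = q.re ^ 2 + q.imI ^ 2 + q.imJ ^ 2 + q.imK ^ 2 := by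
  rw [sq, ← Quaternion.normSq_eq_norm_mul_self, Quaternion.normSq_def']

lemma mem_sphere_iff_sq {p q : ℍ[ℝ]} : p ∈ sphere q ↔ p.re = q.re ∧
    p.imI ^ 2 + p.imJ ^ 2 + p.imK ^ 2 = ‖q.im‖ ^ 2 := by
  rw [mem_sphere_iff, ← norm_im_sq, pow_left_inj₀ (norm_nonneg _) (norm_nonneg _) two_ne_zero]

lemma isPreconnected_sphere_quaternion (q : ℍ[ℝ]) : IsPreconnected (sphere q) := by
  set φ : EuclideanSpace ℝ (Fin 3) → ℍ[ℝ] := fun e => (q.re : ℍ[ℝ]) + ∑ i, e i • unit i with hφ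
  have hcont : Continuous φ := by
    rw [hφ]
    fun_prop
  have hpre : IsPreconnected (Metric.sphere (0 : EuclideanSpace ℝ (Fin 3)) ‖q.im‖) := by
    refine isPreconnected_sphere ?_ 0 _
    rw [← Module.finrank_eq_rank, finrank_euclideanSpace]
    norm_num
  have himg : φ '' Metric.sphere 0 ‖q.im‖ = sphere q := by
    have hnorm : ∀ e : EuclideanSpace ℝ (Fin 3), e ∈ Metric.sphere 0 ‖q.im‖ ↔
        e 0 ^ 2 + e 1 ^ 2 + e 2 ^ 2 = ‖q.im‖ ^ 2 := by
      intro e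
      rw [mem_sphere_zero_iff_norm, ← pow_left_inj₀ (norm_nonneg _) (norm_nonneg _) two_ne_zero,
        EuclideanSpace.real_norm_sq_eq, Fin.sum_univ_three]
    have hco : ∀ e, (φ e).re = q.re ∧ (φ e).imI = e 0 ∧ (φ e).imJ = e 1 ∧ (φ e).imK = e 2 := by
      intro e
      simp [hφ, Fin.sum_univ_three, unit_re, unit_zero_imI, unit_zero_imJ, unit_zero_imK,
        unit_one_imI, unit_one_imJ, unit_one_imK, unit_two_imI, unit_two_imJ, unit_two_imK]
    ext p
    rw [mem_sphere_iff_sq]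
    constructor
    · rintro ⟨e, he, rfl⟩
      obtain ⟨h0, h1, h2, h3⟩ := hco e
      rw [h0, h1, h2, h3]
      exact ⟨rfl, (hnorm e).1 he⟩
    · rintro ⟨h1, h2⟩
      refine ⟨!₂[p.imI, p.imJ, p.imK], (hnorm _).2 (by simpa using h2), ?_⟩
      obtain ⟨h0, h1', h2', h3'⟩ := hco !₂[p.imI, p.imJ, p.imK]
      exact Quaternion.ext _ _ (h0.trans h1.symm) h1' h2' h3'
  rw [← himg]
  exact hpre.image φ hcont.continuousOn

/-- The traces of the spheres `𝕊_q` on a ball which is centred at a real point, or which does not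
meet the real axis, are connected. -/
lemma isPreconnected_sphere_inter_ball (q y : ℍ[ℝ]) {r : ℝ} (hr : 0 < r)
    (h : y.im ≠ 0 → r ≤ ‖y.im‖) : IsPreconnected (sphere q ∩ Metric.ball y r) := by
  -- On the sphere `‖p - y‖²` is an affine function of `p`, so the ball cuts out a half-space.
  have hball : ∀ p ∈ sphere q, p ∈ Metric.ball y r ↔
      ((q.re - y.re) ^ 2 + ‖q.im‖ ^ 2 + ‖y.im‖ ^ 2 - r ^ 2) / 2 <
        p.imI * y.imI + p.imJ * y.imJ + p.imK * y.imK := by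
    intro p hp
    obtain ⟨h1, h2⟩ := mem_sphere_iff_sq.1 hp
    rw [mem_ball_iff_norm, ← pow_lt_pow_iff_left₀ (norm_nonneg _) hr.le two_ne_zero, norm_sq_eq,
      norm_im_sq y, ← h2, ← h1]
    simp only [Quaternion.re_sub, Quaternion.imI_sub, Quaternion.imJ_sub, Quaternion.imK_sub]
    constructor <;> intro h <;> nlinarith
  by_cases hy : y.im = 0
  · have h0 : ∀ p : ℍ[ℝ], p.imI * y.imI + p.imJ * y.imJ + p.imK * y.imK = 0 := by
      intro p
      rw [← Quaternion.imI_im y, ← Quaternion.imJ_im y, ← Quaternion.imK_im y, hy]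
      simp
    by_cases hc : ((q.re - y.re) ^ 2 + ‖q.im‖ ^ 2 + ‖y.im‖ ^ 2 - r ^ 2) / 2 < 0
    · have : sphere q ∩ Metric.ball y r = sphere q :=
        Set.inter_eq_left.2 fun p hp => (hball p hp).2 (by rwa [h0])
      rw [this]
      exact isPreconnected_sphere_quaternion q
    · have : sphere q ∩ Metric.ball y r = ∅ := by
        rw [Set.eq_empty_iff_forall_notMem]
        rintro p ⟨hp, hpb⟩
        exact hc (by simpa only [h0] using (hball p hp).1 hpb)
      rw [this]
      exact isPreconnected_empty
  · have hyr : r ^ 2 ≤ ‖y.im‖ ^ 2 := by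
      have := h hy
      gcongr
    set c := ((q.re - y.re) ^ 2 + ‖q.im‖ ^ 2 + ‖y.im‖ ^ 2 - r ^ 2) / 2 with hc
    have hc0 : 0 ≤ c := by
      rw [hc]
      nlinarith [sq_nonneg (q.re - y.re), sq_nonneg ‖q.im‖]
    -- The cone of all `v` whose imaginary part points towards the cap. It is convex because `c ≥
    -- 0`, which is where the bound on `r` enters, and the cap is its image under radial projection.
    set C : Set ℍ[ℝ] := {v | c * ‖v.im‖ <
      ‖q.im‖ * (v.imI * y.imI + v.imJ * y.imJ + v.imK * y.imK)} with hC
    have hCne : ∀ v ∈ C, v.im ≠ 0 := by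
      intro v hv h0
      have hv' : c * ‖v.im‖ < ‖q.im‖ * (v.imI * y.imI + v.imJ * y.imJ + v.imK * y.imK) := hv
      rw [← Quaternion.imI_im v, ← Quaternion.imJ_im v, ← Quaternion.imK_im v, h0] at hv'
      simp at hv'
    have hconv : Convex ℝ C := by
      intro v hv w hw a b ha hb hab
      have hv' : c * ‖v.im‖ < ‖q.im‖ * (v.imI * y.imI + v.imJ * y.imJ + v.imK * y.imK) := hv
      have hw' : c * ‖w.im‖ < ‖q.im‖ * (w.imI * y.imI + w.imJ * y.imJ + w.imK * y.imK) := hw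
      have h1 : ‖(a • v + b • w).im‖ ≤ a * ‖v.im‖ + b * ‖w.im‖ := by
        rw [Quaternion.im_add, Quaternion.im_smul, Quaternion.im_smul]
        refine (norm_add_le _ _).trans_eq ?_
        rw [norm_smul, norm_smul, Real.norm_of_nonneg ha, Real.norm_of_nonneg hb]
      have h2 := mul_le_mul_of_nonneg_left h1 hc0
      change c * ‖(a • v + b • w).im‖ < _
      refine h2.trans_lt ?_
      simp only [Quaternion.imI_add, Quaternion.imJ_add, Quaternion.imK_add, Quaternion.imI_smul,
        Quaternion.imJ_smul, Quaternion.imK_smul, smul_eq_mul]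
      rcases ha.eq_or_lt with rfl | ha'
      · have hb1 : b = 1 := by linarith
        subst hb1
        linarith
      · have h3 := mul_lt_mul_of_pos_left hv' ha'
        have h4 := mul_le_mul_of_nonneg_left hw'.le hb
        linarith
    set φ : ℍ[ℝ] → ℍ[ℝ] := fun v => (q.re : ℍ[ℝ]) + (‖q.im‖ * ‖v.im‖⁻¹) • v.im with hφ
    have hcont : ContinuousOn φ C := by
      have hn : ContinuousOn (fun v : ℍ[ℝ] => ‖v.im‖) C := Quaternion.continuous_im.norm.continuousOn
      exact continuousOn_const.add ((continuousOn_const.mul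
        (hn.inv₀ fun v hv => norm_ne_zero_iff.2 (hCne v hv))).smul
          Quaternion.continuous_im.continuousOn)
    have himg : φ '' C = sphere q ∩ Metric.ball y r := by
      ext p
      constructor
      · rintro ⟨v, hv, rfl⟩
        have hv0 := norm_ne_zero_iff.2 (hCne v hv)
        have hvp : 0 < ‖v.im‖ := lt_of_le_of_ne (norm_nonneg _) hv0.symm
        have hs : φ v ∈ sphere q := by
          rw [mem_sphere_iff]
          constructor
          · simp [hφ]
          · have : (φ v).im = (‖q.im‖ * ‖v.im‖⁻¹) • v.im := by ext <;> simp [hφ]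
            rw [this, norm_smul, norm_mul, norm_inv, norm_norm, norm_norm,
              inv_mul_cancel_right₀ hv0]
        refine ⟨hs, (hball _ hs).2 ?_⟩
        have hv' : c * ‖v.im‖ < ‖q.im‖ * (v.imI * y.imI + v.imJ * y.imJ + v.imK * y.imK) := hv
        have h5 := (lt_div_iff₀ hvp).2 hv'
        refine h5.trans_eq ?_
        simp [hφ]
        ring
      · rintro ⟨hp, hpb⟩
        have h1 := (hball p hp).1 hpb
        obtain ⟨hre, him⟩ := mem_sphere_iff.1 hp
        have hq0 : 0 < ‖q.im‖ := by
          refine lt_of_le_of_ne (norm_nonneg _) fun h0 => ?_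
          rw [← h0, norm_eq_zero] at him
          rw [← Quaternion.imI_im p, ← Quaternion.imJ_im p, ← Quaternion.imK_im p, him] at h1
          simp at h1
          linarith
        refine ⟨p, ?_, ?_⟩
        · change c * ‖p.im‖ < _
          rw [him, mul_comm]
          exact mul_lt_mul_of_pos_left h1 hq0
        · simp only [hφ]
          rw [him, mul_inv_cancel₀ hq0.ne', one_smul, ← hre]
          exact Quaternion.re_add_im p
    rw [← himg]
    exact hconv.isPreconnected.image φ hcont

variable {n : ℕ}

lemma mem_partialSphere_of_mem {m : ℕ} {a b y : Fin n → ℍ[ℝ]} (ha : a ∈ partialSphere m y)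
    (hb : b ∈ partialSphere m y) : b ∈ partialSphere m a := by
  intro h
  refine ⟨fun hm => ?_, fun hm => by rw [(ha h).2 hm, (hb h).2 hm]⟩
  obtain ⟨h1, h2⟩ := mem_sphere_iff.1 ((ha h).1 hm)
  obtain ⟨h3, h4⟩ := mem_sphere_iff.1 ((hb h).1 hm)
  exact mem_sphere_iff.2 ⟨h3.trans h1.symm, h4.trans h2.symm⟩

/-- In a product of small balls, the trace of a torus is a product of connected traces of spheres,
so locally constant becomes constant. -/
lemma LocallyStronglySlice.exists_sliceOnTori (hn : 1 ≤ n) {U : Set (Fin n → ℍ[ℝ])}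
    (hU : IsOpen U) {f : (Fin n → ℍ[ℝ]) → ℍ[ℝ]} (hf' : ContDiffOn ℝ n f (U \ realLocus n))
    (h : LocallyStronglySlice f U) {y : Fin n → ℍ[ℝ]} (hy : y ∈ U) :
    ∃ V, IsOpen V ∧ y ∈ V ∧ V ⊆ U ∧ SliceOnTori f V := by
  obtain ⟨ε, hε, hball⟩ := Metric.isOpen_iff.1 hU y hy
  have hρ : ∀ h : Fin n, ∃ r, 0 < r ∧ r ≤ ε ∧ ((y h).im ≠ 0 → r ≤ ‖(y h).im‖) := by
    intro h
    by_cases h0 : (y h).im = 0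
    · exact ⟨ε, hε, le_rfl, fun hne => absurd h0 hne⟩
    · exact ⟨min ε ‖(y h).im‖, lt_min hε (norm_pos_iff.2 h0), min_le_left _ _,
        fun _ => min_le_right _ _⟩
  choose ρ hρ0 hρε hρim using hρ
  set V : Set (Fin n → ℍ[ℝ]) := Set.pi Set.univ fun h => Metric.ball (y h) (ρ h) with hV
  have hVo : IsOpen V := isOpen_set_pi Set.finite_univ fun h _ => Metric.isOpen_ball
  have hVU : V ⊆ U := by
    intro x hx
    refine hball ?_
    rw [Metric.mem_ball, dist_pi_lt_iff hε]
    exact fun h => (hx h trivial).trans_le (hρε h)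
  refine ⟨V, hVo, fun h _ => Metric.mem_ball_self (hρ0 h), hVU,
    SliceOnTori.of_gammaIter_const hVo (hf'.mono (Set.sdiff_subset_sdiff_left hVU)) ?_⟩
  intro x hx K a ha b hb
  have hloc := h x ⟨hVU hx.1, hx.2⟩ n hn le_rfl K fun k _ => k.isLt
  have hpre : IsPreconnected (torus x ∩ V) := by
    have : torus x ∩ V = Set.pi Set.univ fun h => sphere (x h) ∩ Metric.ball (y h) (ρ h) := by
      ext p
      simp only [torus, hV, Set.mem_inter_iff, Set.mem_pi, Set.mem_univ, true_implies,
        Set.mem_ofPred_eq, forall_and]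
    rw [this]
    exact isPreconnected_univ_pi fun h =>
      isPreconnected_sphere_inter_ball (x h) (y h) (hρ0 h) (hρim h)
  have hsub : torus x ∩ V ⊆ partialSphere n x ∩ U := by
    rw [partialSphere_self]
    exact Set.inter_subset_inter_right _ hVU
  have hpre' : IsPreconnected
      (Subtype.val ⁻¹' (torus x ∩ V) : Set (partialSphere n x ∩ U : Set (Fin n → ℍ[ℝ]))) := by
    rw [← Topology.IsInducing.subtypeVal.isPreconnected_image, Subtype.image_preimage_coe,
      Set.inter_eq_right.2 hsub]
    exact hpre
  exact hloc.apply_eq_of_isPreconnected hpre' (x := ⟨a, hsub ha⟩) (y := ⟨b, hsub hb⟩) ha hb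

lemma LocallyStronglySlice.of_forall_exists {U : Set (Fin n → ℍ[ℝ])}
    {f : (Fin n → ℍ[ℝ]) → ℍ[ℝ]}
    (h : ∀ y ∈ U, ∃ V, IsOpen V ∧ y ∈ V ∧ V ⊆ U ∧ StronglySlice f V) :
    LocallyStronglySlice f U := by
  intro y hy m hm hmn K hK
  rw [IsLocallyConstant.iff_eventually_eq]
  rintro ⟨a, ha⟩
  obtain ⟨V, hV, haV, -, hs⟩ := h a ha.2
  have har := notMem_realLocus_of_mem_torus (partialSphere_subset_torus m y ha.1) hy.2
  filter_upwards [(hV.preimage continuous_subtype_val).mem_nhds haV] with b hbV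
  exact hs a ⟨haV, har⟩ m hm hmn K hK b ⟨mem_partialSphere_of_mem ha.1 b.2.1, hbV⟩ a
    ⟨mem_partialSphere_of_mem ha.1 ha.1, haV⟩

end

end QuatSlice

end

theorem mainTheorem8 (n : ℕ) (hn : 1 ≤ n) (U : Set (Fin n → ℍ[ℝ])) (hU : IsOpen U)
    (f : (Fin n → ℍ[ℝ]) → ℍ[ℝ]) (hf : ContinuousOn f U)
    (hf' : ContDiffOn ℝ n f (U \ QuatSlice.realLocus n)) :
    ((QuatSlice.StronglySlice f U ↔ ∃ g, QuatSlice.IsSliceExtension f U g) ∧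
      ∀ g₁ g₂, QuatSlice.IsSliceExtension f U g₁ → QuatSlice.IsSliceExtension f U g₂ →
        Set.EqOn g₁ g₂ (QuatSlice.symmCompletion U)) ∧
    (QuatSlice.LocallyStronglySlice f U ↔
      ∀ y ∈ U, ∃ V : Set (Fin n → ℍ[ℝ]), IsOpen V ∧ y ∈ V ∧ V ⊆ U ∧
        ∃ g, QuatSlice.IsSliceExtension f V g) := by
  refine ⟨⟨⟨fun h => ?_, ?_⟩, fun g₁ g₂ h₁ h₂ => h₁.eqOn_symmCompletion hU hf hf' h₂⟩,
    fun h y hy => ?_, fun h => QuatSlice.LocallyStronglySlice.of_forall_exists fun y hy => ?_⟩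
  · exact (h.sliceOnTori hn hU hf').exists_isSliceExtension hU hf hf'
  · rintro ⟨g, hg⟩
    exact hg.sliceOnTori.stronglySlice hU hf'
  · obtain ⟨V, hV, hyV, hVU, hs⟩ := h.exists_sliceOnTori hn hU hf' hy
    exact ⟨V, hV, hyV, hVU, hs.exists_isSliceExtension hV (hf.mono hVU)
      (hf'.mono (Set.sdiff_subset_sdiff_left hVU))⟩
  · obtain ⟨V, hV, hyV, hVU, g, hg⟩ := h y hy
    exact ⟨V, hV, hyV, hVU, hg.sliceOnTori.stronglySlice hV
      (hf'.mono (Set.sdiff_subset_sdiff_left hVU))⟩
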